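/- Definitions. An incidence geometry on a finite point set $P$ is a set $\mathcal B$ of subsets of $P$ (the lines), any two distinct ones of which have at most one common point. It is a configuration if, for some integers $r$ and $k\ge 3$, every point lies on exactly $r$ lines and every line has exactly $k$ points, and a balanced configuration if moreover the number of lines equals the number of points. An isomorphism from $(P_1,\mathcal B_1)$ to $(P_2,\mathcal B_2)$ is a bijection $P_1\to P_2$ that maps $\mathcal B_1$ onto $\mathcal B_2$. A balanced cyclic configuration on $v$ points is a balanced configuration with point set $\mathbb Z_v=\mathbb Z/v\mathbb Z$ for which the translation $x\mapsto x+1$ is an automorphism. Two of them are multiplier equivalent if for some unit $a\in\mathbb Z_v^*$ the map $x\mapsto ax$ is an isomorphism from the first to the second. A cyclic object of order $v$ is a relational structure on $\mathbb Z_v$ that is invariant under $x\mapsto x+1$; a configuration is regarded as a relational structure through the relations "$\{x_1,\dots,x_n\}$ is a line". A set $\Delta$ of permutations of $\mathbb Z_v$ is a solving set for a class $\mathcal K$ of cyclic objects if for every $X\in\mathcal K$ and every cyclic object $Y$ of order $v$, $X$ and $Y$ are isomorphic if and only if $X^\sigma=Y$ for some $\sigma\in\Delta$. Theorem. Let $v=pq$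 with $p,q$ prime, or $v=p^n$ with $p$ prime and $n\ge 0$. Then any two balanced cyclic configurations on $v$ points are isomorphic if and only if they are multiplier equivalent. In other words, the set $\mathbb Z_v^*$ of permutations $x\mapsto ax$ of $\mathbb Z_v$, $a$ a unit, is a solving set for the class of balanced cyclic configurations on $v$ points. -/

import Mathlib

/-- An incidence geometry with point set `P`: a collection of lines, any two of which
share at most one point. -/
structure IncidenceGeometry (P : Type*) [DecidableEq P] where
  lines : Finset (Finset P)
  card_inter_le_one : ∀ B ∈ lines, ∀ B' ∈ lines, B ≠ B' → (B ∩ B').card ≤ 1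

namespace IncidenceGeometry

/-- Every point lies on `r` lines, every line has `k` points, and `3 ≤ k`. -/
def IsConfiguration {P : Type*} [DecidableEq P] (C : IncidenceGeometry P) (r k : ℕ) : Prop :=
  (∀ x : P, (C.lines.filter (fun B => x ∈ B)).card = r) ∧
    (∀ B ∈ C.lines, B.card = k) ∧ 3 ≤ k

/-- A configuration with as many lines as points. -/
def IsBalanced {P : Type*} [DecidableEq P] (C : IncidenceGeometry P) : Prop :=
  (∃ r k : ℕ, C.IsConfiguration r k) ∧ C.lines.card = Nat.card P

/-- The bijection `σ` of the points maps the set of lines of `C` onto the set of lines of `D`. -/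
def IsIsomorphism {P Q : Type*} [DecidableEq P] [DecidableEq Q] (C : IncidenceGeometry P)
    (D : IncidenceGeometry Q) (σ : P ≃ Q) : Prop :=
  C.lines.image (fun B => B.map σ.toEmbedding) = D.lines

def Isomorphic {P Q : Type*} [DecidableEq P] [DecidableEq Q] (C : IncidenceGeometry P)
    (D : IncidenceGeometry Q) : Prop :=
  ∃ σ : P ≃ Q, C.IsIsomorphism D σ

/-- The points are the elements of `ℤ/v`, and the translation `x ↦ x + 1` is an automorphism. -/
def IsCyclic {v : ℕ} (C : IncidenceGeometry (ZMod v)) : Prop :=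
  C.IsIsomorphism C (Equiv.addRight (1 : ZMod v))

/-- Some map `x ↦ a * x` with `a` a unit of `ℤ/v` is an isomorphism from `C` to `D`. -/
def MultiplierEquivalent {v : ℕ} (C D : IncidenceGeometry (ZMod v)) : Prop :=
  ∃ a : (ZMod v)ˣ, C.IsIsomorphism D (Units.mulLeft a)

end IncidenceGeometry

/-- The image `X ^ σ` of a structure `X` on `V` under a permutation `σ` of `V`: a relation holds
of a tuple in `X ^ σ` exactly if it is the image under `σ` of a tuple of which it holds in `X`. -/
@[reducible] def structureImage {L : FirstOrder.Language} {V : Type*} (X : L.Structure V)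
    (σ : Equiv.Perm V) : L.Structure V :=
  letI := X
  σ.inducedStructure

/-- The relational structures on `ℤ/v` that are invariant under `x ↦ x + 1`. -/
def cyclicObjects (L : FirstOrder.Language) [L.IsRelational] (v : ℕ) :
    Set (L.Structure (ZMod v)) :=
  {X | structureImage X (Equiv.addRight (1 : ZMod v)) = X}

/-- The set `Δ` of permutations of `ℤ/v` is a solving set for the class `K` of cyclic objects. -/
def IsSolvingSet {L : FirstOrder.Language} [L.IsRelational] {v : ℕ}
    (K : Set (L.Structure (ZMod v))) (Δ : Set (Equiv.Perm (ZMod v))) : Prop :=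
  K ⊆ cyclicObjects L v ∧
    ∀ X ∈ K, ∀ Y ∈ cyclicObjects L v,
      ((∃ σ : Equiv.Perm (ZMod v), structureImage X σ = Y) ↔ ∃ σ ∈ Δ, structureImage X σ = Y)

/-- The relational language of families of finite sets: one `n`-ary relation symbol for each `n`,
and no function symbols. -/
def lineLanguage : FirstOrder.Language where
  Functions _ := Empty
  Relations _ := Unit

instance : lineLanguage.IsRelational := fun _ => inferInstanceAs (IsEmpty Empty)

/-- An incidence geometry as a relational structure: the `n`-ary relation holds of
`(x₁, …, xₙ)` exactly if `{x₁, …, xₙ}` is a line. -/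
@[reducible] def IncidenceGeometry.toStructure {P : Type*} [DecidableEq P] (C : IncidenceGeometry P) :
    lineLanguage.Structure P where
  funMap f := f.elim
  RelMap {_} _ x := Finset.univ.image x ∈ C.lines

/-- The class of balanced cyclic configurations on `v` points, as relational structures. -/
def balancedCyclicConfigurations (v : ℕ) : Set (lineLanguage.Structure (ZMod v)) :=
  {X | ∃ C : IncidenceGeometry (ZMod v), C.IsBalanced ∧ C.IsCyclic ∧ X = C.toStructure}

/-- The permutations `x ↦ a * x` of `ℤ/v`, for `a` a unit. -/
def multipliers (v : ℕ) : Set (Equiv.Perm (ZMod v)) :=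
  Set.range (fun a : (ZMod v)ˣ => Units.mulLeft a)

/-! Counting flags in a balanced configuration gives `r = k`. In a cyclic one, a line through 0
fixed by a nontrivial translation must be the subgroup of all x with kx = 0. At least three lines
pass through 0, so some line B has trivial translation stabilizer. Its v translates are then all the
lines, and two lines meeting at most once says that B is a Sidon set. An isomorphism is thus a
permutation carrying the translates of B to those of B' (`MapsTranslates`).

The differences of B generate a subgroup, which is determined by its order because the ambient group
is cyclic. An isomorphism respects the cosets of these subgroups, and units lift along ℤ/v → ℤ/m, so
B may be assumed to generate (`IsSidonSet.exists_multiplier`).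

Let c be x ↦ x + 1, let σ be an isomorphism and G the automorphism group of the translates of B.
Then σ⁻¹cσ lies in G. If it is G-conjugate into ⟨c⟩, then σ can be corrected by an element of G to
an affine map, which yields a multiplier (`exists_multiplier_of_generating`). The conjugacy comes
from Sylow theory.

For v = pq with p < q, an element of q-power order in G that commutes with c^p and fixes a point is
trivial (`IsSidonSet.eq_one_of_centralizer`). So q² does not divide |G|, and p² does not divide the
order of the centralizer of c^p in G. Conjugating twice aligns the q-part and then the p-part.

For v = p^n, an affine full cycle in G is a translation (`IsSidonSet.eq_one_of_affine`). Hence ⟨c⟩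
is normal in every Sylow p-subgroup containing it, and any conjugate of a full cycle lying there
falls into ⟨c⟩. -/

/-! ### Sidon sets and automorphisms of their translates -/

section Sidon

variable {A : Type*} [AddCommGroup A]

/-- A finite set all of whose nonzero differences are distinct. -/
def IsSidonSet (B : Finset A) : Prop :=
  ∀ a ∈ B, ∀ b ∈ B, ∀ c ∈ B, ∀ d ∈ B, a - b = c - d → a = b ∨ a = c

/-- A three-term progression would realise the difference `d` twice. -/
theorem IsSidonSet.eq_zero_of_add_mem {B : Finset A} (hB : IsSidonSet B) {x d : A} (h0 : x ∈ B)
    (h1 : x + d ∈ B) (h2 : x + d + d ∈ B) : d = 0 := by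
  rcases hB _ h1 _ h0 _ h2 _ h1 (by abel) with h | h
  · simpa using h
  · simpa using h.symm

/-- If the translates agree, then b, b + (s - t) and b + 2(s - t) form a progression in `B`. So
translates are faithfully indexed by the group, and automorphisms act on it a second time, through
lines. -/
theorem IsSidonSet.translate_injective {B : Finset A} (hB : IsSidonSet B) (hne : B.Nonempty)
    {s t : A} (h : ∀ x, x - s ∈ B ↔ x - t ∈ B) : s = t := by
  obtain ⟨b, hb⟩ := hne
  have h1 : b + (s - t) ∈ B := by
    have := (h (b + s)).1 (by simpa using hb)
    rwa [add_sub_assoc] at this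
  have h2 : b + (s - t) + (s - t) ∈ B := by
    have := (h (b + (s - t) + s)).1 (by simpa using h1)
    rwa [add_sub_assoc] at this
  exact sub_eq_zero.1 (hB.eq_zero_of_add_mem hb h1 h2)

/-- The differences of elements of `B` generate the whole group. -/
def IsDifferenceGenerating (B : Finset A) : Prop :=
  AddSubgroup.closure {d : A | ∃ a ∈ B, ∃ b ∈ B, a - b = d} = ⊤

/-- The permutation `σ` maps the translates of `B` onto the translates of `B'`. -/
def MapsTranslates (B B' : Finset A) (σ : Equiv.Perm A) : Prop :=
  (∀ t, ∃ s, ∀ x, x - t ∈ B ↔ σ x - s ∈ B') ∧ (∀ s, ∃ t, ∀ x, x - t ∈ B ↔ σ x - s ∈ B')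

theorem MapsTranslates.refl (B : Finset A) : MapsTranslates B B 1 :=
  ⟨fun t => ⟨t, fun _ => Iff.rfl⟩, fun t => ⟨t, fun _ => Iff.rfl⟩⟩

theorem MapsTranslates.symm {B B' : Finset A} {σ : Equiv.Perm A} (h : MapsTranslates B B' σ) :
    MapsTranslates B' B σ⁻¹ := by
  refine ⟨fun t => ?_, fun s => ?_⟩
  · obtain ⟨s, hs⟩ := h.2 t
    exact ⟨s, fun x => by rw [hs, Equiv.Perm.coe_inv, Equiv.apply_symm_apply]⟩
  · obtain ⟨t, ht⟩ := h.1 s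
    exact ⟨t, fun x => by rw [ht, Equiv.Perm.coe_inv, Equiv.apply_symm_apply]⟩

theorem MapsTranslates.trans {B B' B'' : Finset A} {σ τ : Equiv.Perm A}
    (h : MapsTranslates B B' σ) (h' : MapsTranslates B' B'' τ) :
    MapsTranslates B B'' (τ * σ) := by
  refine ⟨fun t => ?_, fun u => ?_⟩
  · obtain ⟨s, hs⟩ := h.1 t
    obtain ⟨u, hu⟩ := h'.1 s
    exact ⟨u, fun x => by rw [hs, hu, Equiv.Perm.mul_apply]⟩
  · obtain ⟨s, hs⟩ := h'.2 u
    obtain ⟨t, ht⟩ := h.2 s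
    exact ⟨t, fun x => by rw [ht, hs, Equiv.Perm.mul_apply]⟩

theorem mapsTranslates_addRight (B : Finset A) (c : A) :
    MapsTranslates B B (Equiv.addRight c) :=
  ⟨fun t => ⟨t + c, fun x => by simp⟩, fun s => ⟨s - c, fun x => by
    rw [Equiv.coe_addRight, show x - (s - c) = x + c - s by abel]⟩⟩

/-- The automorphism group of the family of translates of `B`. -/
def translateAut (B : Finset A) : Subgroup (Equiv.Perm A) where
  carrier := {σ | MapsTranslates B B σ}
  one_mem' := MapsTranslates.refl B
  mul_mem' := fun h h' => MapsTranslates.trans h' h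
  inv_mem' := fun h => MapsTranslates.symm h

/-- The action of the automorphism group on the translates of `B`, indexed by the translations. -/
theorem exists_translateAut_action {B : Finset A} (hB : IsSidonSet B) (hne : B.Nonempty) :
    ∃ ψ : translateAut B →* Equiv.Perm A, ∀ (g : translateAut B) (t x : A),
      x - t ∈ B ↔ g.1 x - ψ g t ∈ B := by
  choose f hf using fun g : translateAut B => g.2.1
  have huniq : ∀ (g : translateAut B) (t s : A), (∀ x, x - t ∈ B ↔ g.1 x - s ∈ B) → f g t = s := by
    intro g t s h
    refine hB.translate_injective hne fun y => ?_
    have h1 := hf g t (g.1.symm y)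
    have h2 := h (g.1.symm y)
    rw [Equiv.apply_symm_apply] at h1 h2
    rw [← h1, h2]
  let act : MulAction (translateAut B) A :=
    { smul := f
      one_smul := fun t => huniq 1 t t fun x => Iff.rfl
      mul_smul := fun g h t => huniq (g * h) t _ fun x => by
        rw [hf h t x, hf g (f h t) (h.1 x)]; rfl }
  exact ⟨@MulAction.toPermHom _ A _ act, fun g t x => hf g t x⟩

/-- A permutation which moves every point, and every translate of a generating Sidon set `B`, by an
amount in a subgroup `M`, and which commutes with `M`, is a translation. -/
theorem IsSidonSet.apply_sub_eq {B : Finset A} (hB : IsSidonSet B)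
    (hgen : IsDifferenceGenerating B) (M : AddSubgroup A) {g τ : A → A}
    (hinc : ∀ t x, x - t ∈ B ↔ g x - τ t ∈ B)
    (hg : ∀ x, g x - x ∈ M) (hτ : ∀ t, τ t - t ∈ M)
    (hcomm : ∀ x, ∀ d ∈ M, g (x + d) = g x + d) (x : A) : g x - x = g 0 - 0 := by
  have key : ∀ t x, x - t ∈ B → g x - x = τ t - t := by
    intro t x hx
    -- `d` compares the displacements of a point and an incident line. Applying `g` at `x` and at `x
    -- + d` puts x - t, x - t + d and x - t + 2d all in `B`.
    set d := (g x - x) - (τ t - t) with hd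
    have hdM : d ∈ M := M.sub_mem (hg x) (hτ t)
    have h1 : x - t + d ∈ B := by
      have := (hinc t x).1 hx
      rwa [show x - t + d = g x - τ t by rw [hd]; abel]
    have h2 : x - t + d + d ∈ B := by
      have := (hinc t (x + d)).1 (by rwa [show x + d - t = x - t + d by abel])
      rw [hcomm x d hdM] at this
      rwa [show x - t + d + d = g x + d - τ t by nth_rewrite 1 [hd]; abel]
    exact sub_eq_zero.1 (hB.eq_zero_of_add_mem hx h1 h2)
  have hstep : ∀ d : A, ∀ x, g (x + d) - (x + d) = g x - x := by
    intro d
    have hd : d ∈ AddSubgroup.closure {d : A | ∃ a ∈ B, ∃ b ∈ B, a - b = d} := by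
      rw [hgen]; trivial
    induction hd using AddSubgroup.closure_induction with
    | mem d h =>
      obtain ⟨a, ha, b, hb, rfl⟩ := h
      intro x
      rw [key (x - b) (x + (a - b)) (by rwa [show x + (a - b) - (x - b) = a by abel]),
        key (x - b) x (by rwa [sub_sub_cancel])]
    | zero => simp
    | add d e _ _ hd he => intro x; rw [← add_assoc, he, hd]
    | neg d _ hd => intro x; rw [← hd (x + -d), neg_add_cancel_right]
  simpa using hstep x 0

end Sidon

/-! ### Conjugacy of subgroups of prime order, and the action on residues -/

section CyclicSubgroups

/-- In a finite group whose order is divisible by `p` only once, the subgroups of order `p` are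
conjugate. -/
theorem exists_conj_mem_zpowers_of_not_sq_dvd {Γ : Type*} [Group Γ] [Finite Γ] {p : ℕ}
    (hp : p.Prime) (h : ¬ p ^ 2 ∣ Nat.card Γ) {x y : Γ} (hx : orderOf x = p)
    (hy : orderOf y = p) : ∃ g : Γ, g * y * g⁻¹ ∈ Subgroup.zpowers x := by
  have := Fact.mk hp
  have hdvd : p ∣ Nat.card Γ := hx ▸ orderOf_dvd_natCard x
  have hfac : (Nat.card Γ).factorization p = 1 := by
    have h0 : Nat.card Γ ≠ 0 := Nat.card_pos.ne'
    have h1 := (hp.dvd_iff_one_le_factorization h0).1 hdvd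
    have h2 : ¬ 2 ≤ (Nat.card Γ).factorization p := fun h' =>
      h ((hp.pow_dvd_iff_le_factorization h0).2 h')
    omega
  have hcard : ∀ z : Γ, orderOf z = p →
      Nat.card (Subgroup.zpowers z) = p ^ (Nat.card Γ).factorization p := fun z hz => by
    rw [hfac, pow_one, Nat.card_zpowers, hz]
  obtain ⟨g, hg⟩ := MulAction.exists_smul_eq Γ (Sylow.ofCard _ (hcard y hy))
    (Sylow.ofCard _ (hcard x hx))
  refine ⟨g, ?_⟩
  have h1 : ((g • Sylow.ofCard _ (hcard y hy) : Sylow p Γ) : Subgroup Γ) = Subgroup.zpowers x := by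
    rw [hg]; rfl
  rw [← h1, Sylow.coe_subgroup_smul]
  exact ⟨y, Subgroup.mem_zpowers y, rfl⟩

variable {v : ℕ}

theorem addRight_one_pow (n : ℕ) (x : ZMod v) :
    ((Equiv.addRight (1 : ZMod v)) ^ n : Equiv.Perm (ZMod v)) x = x + n := by
  induction n with
  | zero => simp
  | succ n ih => rw [pow_succ', Equiv.Perm.mul_apply, ih]; simp [add_assoc]

theorem orderOf_addRight_one (v : ℕ) [NeZero v] :
    orderOf (Equiv.addRight (1 : ZMod v) : Equiv.Perm (ZMod v)) = v := by
  refine Nat.dvd_antisymm (orderOf_dvd_of_pow_eq_one ?_) ?_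
  · ext x; simp
  · have := congrArg (fun f : Equiv.Perm (ZMod v) => f 0)
      (pow_orderOf_eq_one (Equiv.addRight (1 : ZMod v) : Equiv.Perm (ZMod v)))
    simp only [addRight_one_pow, zero_add, Equiv.Perm.one_apply] at this
    exact (ZMod.natCast_eq_zero_iff _ _).1 this

theorem mem_zpowers_addRight_one {f : Equiv.Perm (ZMod v)} {t : ZMod v} (h : ∀ x, f x = x + t)
    [NeZero v] : f ∈ Subgroup.zpowers (Equiv.addRight (1 : ZMod v) : Equiv.Perm (ZMod v)) := by
  refine ⟨t.val, ?_⟩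
  ext x
  simp [h]

theorem exists_eq_mul_of_castHom_eq_zero {p : ℕ} [NeZero v] (hpv : p ∣ v) {x : ZMod v}
    (h : ZMod.castHom hpv (ZMod p) x = 0) : ∃ k : ℕ, x = k * p := by
  have h1 : (x.val : ZMod p) = 0 := by
    rw [← h]; conv_rhs => rw [← ZMod.natCast_zmod_val x]
    rw [map_natCast]
  obtain ⟨k, hk⟩ := (ZMod.natCast_eq_zero_iff _ _).1 h1
  refine ⟨k, ?_⟩
  rw [← ZMod.natCast_zmod_val x, hk]
  push_cast
  ring

theorem centralizer_apply_add_mul {p : ℕ} {f : Equiv.Perm (ZMod v)}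
    (hf : f ∈ Subgroup.centralizer {(Equiv.addRight (1 : ZMod v) : Equiv.Perm (ZMod v)) ^ p})
    (n : ℕ) (x : ZMod v) : f (x + n * p) = f x + n * p := by
  have h1 := Subgroup.mem_centralizer_singleton_iff.1 hf
  induction n with
  | zero => simp
  | succ n ih =>
    have h2 := congrArg (fun g : Equiv.Perm (ZMod v) => g (x + n * p)) h1
    simp only [Equiv.Perm.mul_apply, addRight_one_pow, ih] at h2
    push_cast
    rw [add_mul, one_mul, ← add_assoc, ← add_assoc, h2]

/-- A permutation commuting with `x ↦ x + p` acts on the residues mod `p`. -/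
theorem exists_residue_action {p : ℕ} [NeZero v] [NeZero p] (hpv : p ∣ v) :
    ∃ φ : Subgroup.centralizer {(Equiv.addRight (1 : ZMod v) : Equiv.Perm (ZMod v)) ^ p} →*
      Equiv.Perm (ZMod p), ∀ f x, φ f (ZMod.castHom hpv (ZMod p) x) =
        ZMod.castHom hpv (ZMod p) (f.1 x) := by
  set Z := Subgroup.centralizer {(Equiv.addRight (1 : ZMod v) : Equiv.Perm (ZMod v)) ^ p}
  set π := ZMod.castHom hpv (ZMod p)
  have hwd : ∀ (f : Z) (x y : ZMod v), π x = π y → π (f.1 x) = π (f.1 y) := by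
    intro f x y h
    obtain ⟨k, hk⟩ := exists_eq_mul_of_castHom_eq_zero hpv (x := x - y)
      ((map_sub π x y).trans (sub_eq_zero.2 h))
    rw [show x = y + k * p by rw [← hk]; ring, centralizer_apply_add_mul f.2]
    simp
  have hlift : ∀ y : ZMod p, π (y.val : ZMod v) = y := fun y => by
    rw [map_natCast, ZMod.natCast_zmod_val]
  let act : MulAction Z (ZMod p) :=
    { smul := fun f y => π (f.1 (y.val : ZMod v))
      one_smul := fun y => hlift y
      mul_smul := fun f g y => by
        change π (f.1 (g.1 (y.val : ZMod v))) = π (f.1 ((π (g.1 (y.val : ZMod v))).val : ZMod v))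
        exact hwd f _ _ (hlift _).symm }
  exact ⟨@MulAction.toPermHom _ _ _ act, fun f x => hwd f _ _ (hlift _)⟩

end CyclicSubgroups

/-! ### Conjugacy of regular cyclic subgroups for v = pq -/

section TwoPrimes

variable {v p q : ℕ}

theorem not_sq_dvd_factorial {p : ℕ} (hp : p.Prime) : ¬ p ^ 2 ∣ p.factorial := by
  intro h
  obtain ⟨n, rfl⟩ : ∃ n, p = n + 1 := ⟨p - 1, by have := hp.pos; omega⟩
  rw [Nat.factorial_succ, pow_two, Nat.mul_dvd_mul_iff_left hp.pos, hp.dvd_factorial] at h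
  omega

/-- If the elements of `q`-power order commuting with `x ↦ x + p` act semiregularly, then any two
regular cyclic subgroups of a permutation group of degree `pq` are conjugate. -/
theorem exists_conj_mem_zpowers_of_two_primes [NeZero v] (hp : p.Prime) (hq : q.Prime)
    (hpq : p < q) (hv : v = p * q) {G : Subgroup (Equiv.Perm (ZMod v))}
    {c : Equiv.Perm (ZMod v)} (hcdef : c = Equiv.addRight 1) (hc : c ∈ G)
    (hfree : ∀ g ∈ G, g ∈ Subgroup.centralizer {c ^ p} → g ^ q ^ 2 = 1 → g 0 = 0 → g = 1)
    {d : Equiv.Perm (ZMod v)} (hd : d ∈ G) (hdv : orderOf d = v) :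
    ∃ g ∈ G, g * d * g⁻¹ ∈ Subgroup.zpowers c := by
  have := Fact.mk hp
  have := Fact.mk hq
  have hcv : orderOf c = v := hcdef ▸ orderOf_addRight_one v
  have hpv : p ∣ v := ⟨q, hv⟩
  have hqv : q ∣ v := ⟨p, by rw [mul_comm]; exact hv⟩
  have hord_p : ∀ x : Equiv.Perm (ZMod v), orderOf x = v → orderOf (x ^ p) = q := fun x hx => by
    rw [orderOf_pow_of_dvd hp.ne_zero (hpv.trans hx.symm.dvd), hx, hv, Nat.mul_div_cancel_left _ hp.pos]
  have hord_q : ∀ x : Equiv.Perm (ZMod v), orderOf x = v → orderOf (x ^ q) = p := fun x hx => by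
    rw [orderOf_pow_of_dvd hq.ne_zero (hqv.trans hx.symm.dvd), hx, hv,
      Nat.mul_div_cancel _ hq.pos]
  -- The Sylow `q`-subgroups of `G` have order `q`.
  have hGq : ¬ q ^ 2 ∣ Nat.card G := by
    intro hdvd
    set x : G := ⟨c ^ p, G.pow_mem hc p⟩ with hx
    have hxq : orderOf x = q := by rw [hx, ← Subgroup.orderOf_coe]; exact hord_p c hcv
    -- Enlarge ⟨c^p⟩ to a group of order q². It is abelian, so it centralizes c^p; since q² > pq, it
    -- cannot act freely.
    obtain ⟨K, hK, hle⟩ := Sylow.exists_subgroup_card_pow_succ (p := q) (n := 1) hdvd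
      (H := Subgroup.zpowers x) (by rw [Nat.card_zpowers, hxq, pow_one])
    have hKcomm := IsPGroup.isMulCommutative_of_card_eq_prime_sq (p := q) (G := K) hK
    have hstab : MulAction.stabilizer K (0 : ZMod v) ≠ ⊥ := by
      intro hbot
      have h1 := (MulAction.stabilizer K (0 : ZMod v)).index_mul_card
      rw [hbot, Subgroup.card_bot, mul_one, hK, ← hbot, MulAction.index_stabilizer] at h1
      have h2 : (MulAction.orbit K (0 : ZMod v)).ncard ≤ Nat.card (ZMod v) :=
        Set.ncard_le_card _
      rw [h1, Nat.card_zmod, hv] at h2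
      have : p * q < q ^ (1 + 1) := by
        rw [pow_succ, pow_one]; exact Nat.mul_lt_mul_of_pos_right hpq hq.pos
      omega
    obtain ⟨⟨k, hk⟩, hk1⟩ := Subgroup.ne_bot_iff_exists_ne_one.1 hstab
    replace hk1 : k ≠ 1 := fun h => hk1 (Subtype.ext h)
    refine hk1 (Subtype.ext (Subtype.ext (hfree k.1.1 k.1.2 ?_ ?_ hk)))
    · have h1 := hKcomm.is_comm.comm k ⟨x, hle (Subgroup.mem_zpowers x)⟩
      exact Subgroup.mem_centralizer_singleton_iff.2
        (congrArg (fun z : K => (z.1.1 : Equiv.Perm (ZMod v))) h1)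
    · have h1 : k ^ q ^ 2 = 1 := by rw [← hK]; exact pow_card_eq_one'
      simpa using congrArg (fun z : K => (z.1.1 : Equiv.Perm (ZMod v))) h1
  obtain ⟨g, hg⟩ := exists_conj_mem_zpowers_of_not_sq_dvd hq hGq
    (x := ⟨c ^ p, G.pow_mem hc p⟩) (y := ⟨d ^ p, G.pow_mem hd p⟩)
    (by rw [← Subgroup.orderOf_coe]; exact hord_p c hcv)
    (by rw [← Subgroup.orderOf_coe]; exact hord_p d hdv)
  set d' := g.1 * d * g.1⁻¹ with hd'
  have hd'G : d' ∈ G := G.mul_mem (G.mul_mem g.2 hd) (G.inv_mem g.2)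
  have hd'v : orderOf d' = v := by
    refine Eq.trans ?_ hdv
    exact orderOf_injective (MulAut.conj g.1).toMonoidHom (MulAut.conj g.1).injective d
  have hd'p : d' ^ p ∈ Subgroup.zpowers (c ^ p) := by
    obtain ⟨i, hi⟩ := hg
    refine ⟨i, ?_⟩
    have := congrArg (Subtype.val) hi
    simp only [Subgroup.coe_zpow, Subgroup.coe_mul, Subgroup.coe_inv] at this
    rw [hd', conj_pow]
    exact this
  -- Both groups have order q. Equality makes c^p a power of d', so d' centralizes it too.
  have hzp : Subgroup.zpowers (d' ^ p) = Subgroup.zpowers (c ^ p) := by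
    refine Subgroup.eq_of_le_of_card_ge (Subgroup.zpowers_le.2 hd'p) ?_
    rw [Nat.card_zpowers, Nat.card_zpowers, hord_p c hcv, hord_p d' hd'v]
  set C := G ⊓ Subgroup.centralizer {c ^ p} with hC
  have hcC : c ∈ C :=
    ⟨hc, Subgroup.mem_centralizer_singleton_iff.2 (Commute.self_pow c p)⟩
  have hdC : d' ∈ C := by
    refine ⟨hd'G, Subgroup.mem_centralizer_singleton_iff.2 ?_⟩
    have : c ^ p ∈ Subgroup.zpowers (d' ^ p) := hzp ▸ Subgroup.mem_zpowers _
    obtain ⟨i, hi⟩ := this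
    simp only at hi
    rw [← hi]
    exact ((Commute.self_pow d' p).zpow_right i)
  -- The Sylow `p`-subgroups of the centralizer have order `p`.
  have : NeZero p := ⟨hp.ne_zero⟩
  have hCp : ¬ p ^ 2 ∣ Nat.card C := by
    intro hdvd
    obtain ⟨S, hS⟩ := Sylow.exists_subgroup_card_pow_prime p hdvd
    obtain ⟨φ, hφ⟩ := exists_residue_action (v := v) hpv
    let ι : C →* Subgroup.centralizer {(Equiv.addRight (1 : ZMod v) : Equiv.Perm (ZMod v)) ^ p} :=
      Subgroup.inclusion (hcdef ▸ inf_le_right)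
    -- An element of the kernel moves each x by some kp, and its p²-th power moves x by p²·kp. This
    -- is 0 mod pq only if q divides k, so x was fixed. Hence `S` embeds in Sym(p), whose order p²
    -- does not divide.
    have hinj : Function.Injective ((φ.comp ι).comp S.subtype) := by
      rw [injective_iff_map_eq_one]
      intro s hs
      have hpow : s.1.1 ^ p ^ 2 = 1 := by
        have h1 : s ^ p ^ 2 = 1 := by rw [← hS]; exact pow_card_eq_one'
        simpa using congrArg (fun z : S => (z.1.1 : Equiv.Perm (ZMod v))) h1
      have hZ := (ι s.1).2
      refine Subtype.ext (Subtype.ext (Equiv.ext fun x => ?_))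
      change s.1.1 x = x
      have h1 : ZMod.castHom hpv (ZMod p) (s.1.1 x - x) = 0 := by
        rw [map_sub, sub_eq_zero]
        have := hφ (ι s.1) x
        rw [show φ (ι s.1) = 1 from hs] at this
        exact this.symm
      obtain ⟨k, hk⟩ := exists_eq_mul_of_castHom_eq_zero hpv h1
      have h2 : ∀ n : ℕ, (s.1.1 ^ n) x = x + n * (k * p) := by
        intro n
        induction n with
        | zero => simp
        | succ n ih =>
          rw [pow_succ', Equiv.Perm.mul_apply, ih]
          have h3 := centralizer_apply_add_mul hZ (n * k) x
          push_cast at h3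
          rw [mul_assoc] at h3
          change s.1.1 (x + n * (k * p)) = s.1.1 x + _ at h3
          rw [h3, sub_eq_iff_eq_add.1 hk]
          push_cast
          ring
      have h3 := h2 (p ^ 2)
      rw [hpow, Equiv.Perm.one_apply, left_eq_add] at h3
      have h4 : ((p ^ 2 * (k * p) : ℕ) : ZMod v) = 0 := by exact_mod_cast h3
      rw [ZMod.natCast_eq_zero_iff, hv] at h4
      have h5 : q ∣ k := by
        have h6 : q ∣ p ^ 2 * (k * p) := dvd_trans ⟨p, mul_comm _ _⟩ h4
        have hqp : Nat.Coprime q p := (Nat.coprime_primes hq hp).2 hpq.ne'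
        exact hqp.dvd_of_dvd_mul_right ((hqp.pow_right 2).dvd_of_dvd_mul_left h6)
      have h7 : ((k * p : ℕ) : ZMod v) = 0 := by
        rw [ZMod.natCast_eq_zero_iff, hv, mul_comm p q]
        exact Nat.mul_dvd_mul_right h5 p
      rw [sub_eq_iff_eq_add.1 hk]
      push_cast at h7
      rw [h7, zero_add]
    have h1 := Subgroup.card_dvd_of_injective _ hinj
    rw [hS, Nat.card_perm, Nat.card_zmod] at h1
    exact not_sq_dvd_factorial hp h1
  obtain ⟨h, hh⟩ := exists_conj_mem_zpowers_of_not_sq_dvd hp hCp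
    (x := ⟨c ^ q, C.pow_mem hcC q⟩) (y := ⟨d' ^ q, C.pow_mem hdC q⟩)
    (by rw [← Subgroup.orderOf_coe]; exact hord_q c hcv)
    (by rw [← Subgroup.orderOf_coe]; exact hord_q d' hd'v)
  refine ⟨h.1 * g.1, G.mul_mem h.2.1 g.2, ?_⟩
  have heq : h.1 * g.1 * d * (h.1 * g.1)⁻¹ = h.1 * d' * h.1⁻¹ := by rw [hd']; group
  rw [heq]
  have hq' : (h.1 * d' * h.1⁻¹) ^ q ∈ Subgroup.zpowers c := by
    obtain ⟨i, hi⟩ := hh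
    have := congrArg (Subtype.val) hi
    simp only [Subgroup.coe_zpow, Subgroup.coe_mul, Subgroup.coe_inv] at this
    rw [conj_pow, ← this]
    exact (Subgroup.zpowers c).zpow_mem ((Subgroup.zpowers c).pow_mem (Subgroup.mem_zpowers c) q) i
  -- `h` centralizes c^p, so the second conjugation leaves the already aligned q-part alone.
  have hp' : (h.1 * d' * h.1⁻¹) ^ p ∈ Subgroup.zpowers c := by
    have h1 : Commute h.1 (d' ^ p) := by
      obtain ⟨i, hi⟩ := hd'p
      simp only at hi
      rw [← hi]
      exact Commute.zpow_right (Subgroup.mem_centralizer_singleton_iff.1 h.2.2) i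
    rw [conj_pow, h1.eq, mul_inv_cancel_right]
    obtain ⟨i, hi⟩ := hd'p
    simp only at hi
    rw [← hi]
    exact (Subgroup.zpowers c).zpow_mem ((Subgroup.zpowers c).pow_mem (Subgroup.mem_zpowers c) p) i
  set e := h.1 * d' * h.1⁻¹
  have hbez : (p : ℤ) * Nat.gcdA p q + q * Nat.gcdB p q = 1 := by
    rw [← Nat.gcd_eq_gcd_ab, (Nat.coprime_primes hp hq).2 hpq.ne, Nat.cast_one]
  rw [← zpow_one e, ← hbez, zpow_add, zpow_mul, zpow_mul, zpow_natCast, zpow_natCast]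
  exact Subgroup.mul_mem _ (Subgroup.zpow_mem _ hp' _) (Subgroup.zpow_mem _ hq' _)

/-- For `p < q`, an automorphism of `q`-power order which commutes with `x ↦ x + p` and fixes a
point is trivial. -/
theorem IsSidonSet.eq_one_of_centralizer [NeZero v] (hp : p.Prime) (hq : q.Prime)
    (hpq : p < q) (hpv : p ∣ v) {B : Finset (ZMod v)} (hB : IsSidonSet B) (hne : B.Nonempty)
    (hgen : IsDifferenceGenerating B) {g : Equiv.Perm (ZMod v)} (hg : g ∈ translateAut B)
    (hgc : g ∈ Subgroup.centralizer {(Equiv.addRight (1 : ZMod v) : Equiv.Perm (ZMod v)) ^ p})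
    {n : ℕ} (hgn : g ^ q ^ n = 1) (h0 : g 0 = 0) : g = 1 := by
  have : NeZero p := ⟨hp.ne_zero⟩
  obtain ⟨ψ, hψ⟩ := exists_translateAut_action hB hne
  obtain ⟨φ, hφ⟩ := exists_residue_action (v := v) hpv
  -- An element of q-power order has trivial image in Sym(p), since q > p. This is used for points
  -- and again for the indices of lines.
  have hblock : ∀ f : Subgroup.centralizer
      {(Equiv.addRight (1 : ZMod v) : Equiv.Perm (ZMod v)) ^ p}, f ^ q ^ n = 1 →
      ∀ x, f.1 x - x ∈ (ZMod.castHom hpv (ZMod p)).toAddMonoidHom.ker := by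
    intro f hf x
    have h1 : orderOf (φ f) ∣ q ^ n :=
      orderOf_dvd_of_pow_eq_one (by rw [← map_pow, hf, map_one])
    have h2 : orderOf (φ f) ∣ p.factorial := by
      have := orderOf_dvd_natCard (φ f)
      rwa [Nat.card_perm, Nat.card_zmod] at this
    have h3 : Nat.Coprime (q ^ n) p.factorial :=
      Nat.Coprime.pow_left n ((Nat.Prime.coprime_iff_not_dvd hq).2 fun h =>
        absurd (hq.dvd_factorial.1 h) (by omega))
    have h4 : φ f = 1 := orderOf_eq_one_iff.1 (Nat.eq_one_of_dvd_coprimes h3 h1 h2)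
    have h5 := hφ f x
    rw [h4] at h5
    change ZMod.castHom hpv (ZMod p) (f.1 x - x) = 0
    rw [map_sub, ← h5]; simp
  have hcG : (Equiv.addRight (1 : ZMod v) : Equiv.Perm (ZMod v)) ∈ translateAut B :=
    mapsTranslates_addRight B 1
  set c : translateAut B := ⟨_, hcG⟩ with hc
  have hψc : ψ c = Equiv.addRight 1 := by
    ext t
    refine (hB.translate_injective hne fun x => ?_).symm
    have := hψ c t (x - 1)
    rw [← show x - 1 - t = x - (Equiv.addRight 1) t by simp; ring]
    rw [this, hc]
    simp
  have hgc' : ψ ⟨g, hg⟩ ∈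
      Subgroup.centralizer {(Equiv.addRight (1 : ZMod v) : Equiv.Perm (ZMod v)) ^ p} := by
    rw [Subgroup.mem_centralizer_singleton_iff, ← hψc, ← map_pow, ← map_mul, ← map_mul]
    congr 1
    exact Subtype.ext (Subgroup.mem_centralizer_singleton_iff.1 hgc)
  ext1 x
  have h1 := hB.apply_sub_eq hgen (ZMod.castHom hpv (ZMod p)).toAddMonoidHom.ker
    (g := g) (τ := ψ ⟨g, hg⟩) (hψ ⟨g, hg⟩)
    (hblock ⟨g, hgc⟩ (Subtype.ext hgn))
    (hblock ⟨_, hgc'⟩ (Subtype.ext (by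
      change ψ ⟨g, hg⟩ ^ q ^ n = 1
      rw [← map_pow, show (⟨g, hg⟩ : translateAut B) ^ q ^ n = 1 from Subtype.ext hgn, map_one])))
    (fun x d hd => by
      obtain ⟨k, rfl⟩ := exists_eq_mul_of_castHom_eq_zero hpv hd
      exact centralizer_apply_add_mul hgc k x) x
  rw [h0, sub_zero, sub_eq_zero] at h1
  exact h1

end TwoPrimes

/-! ### Affine maps and Sidon sets modulo a prime power -/

section PrimePower

variable {v p n : ℕ}

theorem ZMod.natCast_dvd_or_isUnit_of_prime_pow [NeZero v] (hp : p.Prime) (hv : v = p ^ n)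
    (z : ZMod v) : (p : ZMod v) ∣ z ∨ IsUnit z := by
  rw [← ZMod.natCast_zmod_val z]
  by_cases h : p ∣ z.val
  · exact Or.inl (by exact_mod_cast (Nat.cast_dvd_cast h : ((p : ℕ) : ZMod v) ∣ (z.val : ZMod v)))
  · refine Or.inr ((ZMod.isUnit_iff_coprime _ _).2 ?_)
    have : Nat.Coprime z.val (p ^ n) :=
      Nat.Coprime.pow_right n ((hp.coprime_iff_not_dvd.2 h).symm)
    rwa [← hv] at this

theorem natCast_dvd_iff_castHom_eq_zero [NeZero v] (hpv : p ∣ v) {z : ZMod v} :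
    (p : ZMod v) ∣ z ↔ ZMod.castHom hpv (ZMod p) z = 0 := by
  constructor
  · rintro ⟨k, rfl⟩
    rw [map_mul, map_natCast, ZMod.natCast_self, zero_mul]
  · intro h
    obtain ⟨k, hk⟩ := exists_eq_mul_of_castHom_eq_zero hpv h
    exact ⟨k, by rw [hk, mul_comm]⟩

theorem ZMod.sum_univ_eq_zero_of_odd [NeZero p] (h : Odd p) : ∑ y : ZMod p, y = 0 := by
  have h1 : ∑ y : ZMod p, y = ∑ y : ZMod p, -y :=
    (Equiv.sum_comp (Equiv.neg (ZMod p)) fun y => y).symm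
  rw [Finset.sum_neg_distrib] at h1
  exact (ZMod.add_self_eq_zero_iff_eq_zero h).1 (by nth_rewrite 1 [h1]; simp)

/-- A generating Sidon set in `ℤ/pⁿ` with at least three elements is not invariant under a map
`x ↦ (1 + e) x - t`, where `e ≠ 0` is divisible by `p` and killed by `p`. -/
theorem IsSidonSet.false_of_affine_invariant [NeZero v] (hp : p.Prime) (hv : v = p ^ n)
    (hpv : p ∣ v) {B : Finset (ZMod v)} (hB : IsSidonSet B) (hcard : 3 ≤ B.card)
    (hgen : ∃ x ∈ B, ∃ y ∈ B, ¬ (p : ZMod v) ∣ x - y) {e t : ZMod v} (he : e ≠ 0)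
    (hpe : p * e = 0) (hdvd : (p : ZMod v) ∣ e) (hinv : ∀ x ∈ B, x + e * x - t ∈ B) : False := by
  have hann : ∀ z : ZMod v, e * z = 0 ↔ (p : ZMod v) ∣ z := by
    intro z
    constructor
    · intro h
      rcases ZMod.natCast_dvd_or_isUnit_of_prime_pow hp hv z with h1 | h1
      · exact h1
      · exact absurd (h1.mul_left_eq_zero.1 h) he
    · rintro ⟨k, rfl⟩
      rw [← mul_assoc, mul_comm e, hpe, zero_mul]
  -- The displacement ex - t depends only on x mod p, so two points in one residue class give the
  -- same difference; the Sidon property leaves only these two cases.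
  have hclass : ∀ x ∈ B, ∀ y ∈ B, (p : ZMod v) ∣ x - y → e * x = t ∨ x = y := by
    intro x hx y hy h
    have h1 : e * x = e * y := by rw [← sub_eq_zero, ← mul_sub, hann]; exact h
    rcases hB _ (hinv x hx) _ hx _ (hinv y hy) _ hy (by rw [h1]; ring) with h2 | h2
    · left
      have : e * x - t = 0 := by
        rw [show e * x - t = (x + e * x - t) - x by ring, h2, sub_self]
      exact sub_eq_zero.1 this
    · right
      rw [h1] at h2
      have : x = y := by
        have := sub_left_inj.1 h2
        exact add_right_cancel this
      exact this
  have hfix : ∀ x ∈ B, (p : ZMod v) ∣ t → e * x = t := by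
    intro x hx ht
    have h1 : (p : ZMod v) ∣ x - (x + e * x - t) := by
      rw [show x - (x + e * x - t) = t - e * x by ring]
      exact dvd_sub ht (hdvd.mul_right x)
    rcases hclass x hx _ (hinv x hx) h1 with h2 | h2
    · exact h2
    · have : e * x - t = 0 := by
        rw [show e * x - t = (x + e * x - t) - x by ring, ← h2, sub_self]
      exact sub_eq_zero.1 this
  obtain ⟨x, hx, y, hy, hxy⟩ := hgen
  -- If p divides t, every point of `B` is fixed, so ex is constant on `B` and all its points are
  -- congruent mod p. Otherwise no point is fixed, and `B` injects into ℤ/p with an image invariant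
  -- under a nonzero translation, hence onto.
  by_cases ht : (p : ZMod v) ∣ t
  · exact hxy ((hann _).1 (by rw [mul_sub, hfix x hx ht, hfix y hy ht, sub_self]))
  have := Fact.mk hp
  set π := ZMod.castHom hpv (ZMod p) with hπ
  have hdvd_iff : ∀ z : ZMod v, (p : ZMod v) ∣ z ↔ π z = 0 := fun z =>
    natCast_dvd_iff_castHom_eq_zero hpv
  have hinj : Set.InjOn π B := by
    intro a ha b hb hab
    rcases hclass a ha b hb ((hdvd_iff _).2 (by rw [map_sub, hab, sub_self])) with h | h
    · exact absurd (h ▸ hdvd.mul_right a) ht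
    · exact h
  have ht0 : π t ≠ 0 := fun h => ht ((hdvd_iff t).2 h)
  have hstep : ∀ i : ℕ, π x - i * π t ∈ B.image π := by
    intro i
    induction i with
    | zero => simpa using Finset.mem_image_of_mem π hx
    | succ i ih =>
      obtain ⟨b, hb, hbi⟩ := Finset.mem_image.1 ih
      refine Finset.mem_image.2 ⟨_, hinv b hb, ?_⟩
      rw [map_sub, map_add, map_mul, (hdvd_iff e).1 hdvd, hbi]
      push_cast
      ring
  have himage : B.image π = Finset.univ := by
    refine Finset.eq_univ_of_forall fun y => ?_
    have := hstep ((π x - y) / π t).val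
    rwa [ZMod.natCast_zmod_val, div_mul_cancel₀ _ ht0, sub_sub_cancel] at this
  have hBp : B.card = p := by
    rw [← Finset.card_image_of_injOn hinj, himage, Finset.card_univ, ZMod.card]
  -- Here p = |B| ≥ 3.
  have hodd : Odd p := hp.odd_of_ne_two (by omega)
  have hsum : π (∑ b ∈ B, b) = 0 := by
    rw [map_sum, ← Finset.sum_image (f := fun y => y) hinj, himage]
    exact ZMod.sum_univ_eq_zero_of_odd hodd
  have hmap : ∑ b ∈ B, (b + e * b - t) = ∑ b ∈ B, b := by
    have hinj' : Set.InjOn (fun b => b + e * b - t) B := by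
      intro a ha b hb hab
      refine hinj ha hb ?_
      have h1 := congrArg π hab
      simp only [map_sub, map_add, map_mul, (hdvd_iff e).1 hdvd, zero_mul, add_zero] at h1
      exact sub_left_inj.1 h1
    rw [← Finset.sum_image (f := fun y => y) hinj',
      Finset.eq_of_subset_of_card_le (Finset.image_subset_iff.2 hinv)
        (Finset.card_image_of_injOn hinj').ge]
  -- The map permutes `B`, so comparing sums gives e·ΣB = pt. The left side vanishes because ΣB is 0
  -- mod p.
  have hpt : (p : ZMod v) * t = 0 := by
    rw [Finset.sum_sub_distrib, Finset.sum_add_distrib, ← Finset.mul_sum,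
      (hann _).2 ((hdvd_iff _).2 hsum), add_zero, Finset.sum_const, hBp, nsmul_eq_mul,
      sub_eq_self] at hmap
    exact hmap
  rcases ZMod.natCast_dvd_or_isUnit_of_prime_pow hp hv t with h1 | h1
  · exact ht h1
  · have h2 : (p : ZMod v) = 0 := h1.mul_left_eq_zero.1 hpt
    rw [h2, zero_dvd_iff] at hdvd
    exact he hdvd

/-- If `a ≡ 1` mod `p` (mod `4` for `p = 2`) and `a ^ p = 1` in `ℤ/pⁿ`, then `p (a - 1) = 0`. -/
theorem ZMod.mul_sub_one_eq_zero_of_pow_eq_one [NeZero v] (hp : p.Prime) (hv : v = p ^ n)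
    {a : ℤ} (ha : (p : ℤ) ∣ a - 1) (ha4 : p = 2 → (4 : ℤ) ∣ a - 1)
    (hpow : (a : ZMod v) ^ p = 1) : (p : ZMod v) * ((a : ZMod v) - 1) = 0 := by
  have hpa : ¬ (p : ℤ) ∣ a := by
    intro h
    have h1 : (p : ℤ) ∣ 1 := by simpa using dvd_sub h ha
    exact hp.one_lt.ne' (by exact_mod_cast Int.eq_one_of_dvd_one (by positivity) h1)
  -- Lifting the exponent; for p = 2 this form needs the hypothesis mod 4.
  have hlte : emultiplicity (p : ℤ) (a ^ p - 1 ^ p) =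
      emultiplicity (p : ℤ) (a - 1) + emultiplicity p p := by
    rcases hp.eq_two_or_odd' with h2 | hodd
    · subst h2
      have := Int.two_pow_sub_pow' (x := a) (y := 1) 2 (ha4 rfl) (by simpa using hpa)
      rw [← Int.natCast_emultiplicity]
      simpa using this
    · exact Int.emultiplicity_pow_sub_pow hp hodd ha hpa p
  have hpZ : Prime (p : ℤ) := Nat.prime_iff_prime_int.1 hp
  have h1 : (p : ℤ) ^ n ∣ a ^ p - 1 ^ p := by
    have : ((a ^ p - 1 ^ p : ℤ) : ZMod v) = 0 := by push_cast; rw [hpow]; simp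
    rw [ZMod.intCast_zmod_eq_zero_iff_dvd, hv] at this
    exact_mod_cast this
  have h2 : (p : ℤ) ^ n ∣ p * (a - 1) := by
    rw [pow_dvd_iff_le_emultiplicity] at h1 ⊢
    rw [hlte] at h1
    rw [emultiplicity_mul hpZ, add_comm, Int.natCast_emultiplicity]
    exact h1
  have h3 : ((p * (a - 1) : ℤ) : ZMod v) = 0 := by
    rw [ZMod.intCast_zmod_eq_zero_iff_dvd, hv]
    exact_mod_cast h2
  exact_mod_cast h3

end PrimePower

/-! ### Affine full cycles, and conjugacy through normalizers in p-groups -/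

section PrimePowerConj

variable {v p n : ℕ}

theorem apply_eq_of_mul_addRight_one_eq [NeZero v] {f : Equiv.Perm (ZMod v)} {i : ZMod v}
    (h : ∀ x, f (x + 1) = f x + i) (x : ZMod v) : f x = f 0 + i * x := by
  have key : ∀ k : ℕ, f k = f 0 + i * k := by
    intro k
    induction k with
    | zero => simp
    | succ k ih => push_cast; rw [h, ih]; ring
  simpa using key x.val

theorem addRight_one_zpow (i : ℤ) (x : ZMod v) :
    ((Equiv.addRight (1 : ZMod v)) ^ i : Equiv.Perm (ZMod v)) x = x + i := by
  simp

theorem apply_pow_of_conj_addRight_one {h τ : Equiv.Perm (ZMod v)}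
    (hτ : h = τ * Equiv.addRight 1 * τ⁻¹) (k : ℕ) (x : ZMod v) :
    (h ^ k) x = τ (τ.symm x + k) := by
  rw [hτ, conj_pow, Equiv.Perm.mul_apply, Equiv.Perm.mul_apply, addRight_one_pow]
  rfl

theorem apply_pow_of_affine {f : Equiv.Perm (ZMod v)} {a t : ZMod v}
    (h : ∀ x, f x = a * x + t) (k : ℕ) : ∃ s, ∀ x, (f ^ k) x = a ^ k * x + s := by
  induction k with
  | zero => exact ⟨0, by simp⟩
  | succ k ih =>
    obtain ⟨s, hs⟩ := ih
    exact ⟨a * s + t, fun x => by rw [pow_succ', Equiv.Perm.mul_apply, hs, h]; ring⟩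

/-- An affine map with odd multiplier which is a full cycle on `ℤ/4m` has multiplier `1` mod `4`. -/
theorem castHom_four_eq_one [NeZero v] (h4 : 4 ∣ v) {h τ : Equiv.Perm (ZMod v)}
    (hτ : h = τ * Equiv.addRight 1 * τ⁻¹) {a t : ZMod v} (haff : ∀ x, h x = a * x + t)
    (hodd : ∃ k, a - 1 = 2 * k) : ZMod.castHom h4 (ZMod 4) a = 1 := by
  set ρ := ZMod.castHom h4 (ZMod 4)
  obtain ⟨k, hk⟩ := hodd
  have h1 : ρ a - 1 = 2 * ρ k := by
    rw [← map_one ρ, ← map_sub, hk, map_mul, map_ofNat]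
  have h2 : ∀ x y : ZMod 4, x - 1 = 2 * y → x = 1 ∨ x = 3 := by decide
  rcases h2 _ _ h1 with h3 | h3
  · exact h3
  exfalso
  -- With multiplier 3 mod 4, the orbit of 0 alternates between 0 and t mod 4, since 3t + t = 0. A
  -- full cycle must reach all four residues.
  have horb : ∀ k : ℕ, ρ ((h ^ k) 0) = 0 ∨ ρ ((h ^ k) 0) = ρ t := by
    intro k
    induction k with
    | zero => simp
    | succ k ih =>
      rw [pow_succ', Equiv.Perm.mul_apply, haff, map_add, map_mul, h3]
      rcases ih with ih | ih
      · right; rw [ih]; ring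
      · left
        rw [ih]
        generalize ρ t = s
        revert s
        decide
  have h4' : ∀ s : ZMod 4, ∃ y, y ≠ 0 ∧ y ≠ s := by decide
  obtain ⟨y, hy0, hyt⟩ := h4' (ρ t)
  obtain ⟨z, rfl⟩ := ZMod.castHom_surjective h4 y
  have h5 := apply_pow_of_conj_addRight_one hτ (τ.symm z - τ.symm 0).val 0
  rw [ZMod.natCast_zmod_val, add_sub_cancel, Equiv.apply_symm_apply] at h5
  rcases horb (τ.symm z - τ.symm 0).val with h6 | h6
  · rw [h5] at h6; exact hy0 h6
  · rw [h5] at h6; exact hyt h6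

/-- The affine full cycles which preserve the translates of `B` are translations. -/
theorem IsSidonSet.eq_one_of_affine [NeZero v] (hp : p.Prime) (hv : v = p ^ n)
    {B : Finset (ZMod v)} (hB : IsSidonSet B) (hcard : 3 ≤ B.card)
    (hgen : IsDifferenceGenerating B) {h τ : Equiv.Perm (ZMod v)} (hh : h ∈ translateAut B)
    (hτ : h = τ * Equiv.addRight 1 * τ⁻¹) {a t : ZMod v} (haff : ∀ x, h x = a * x + t) :
    a = 1 := by
  by_contra ha1
  have := Fact.mk hp
  have hn : n ≠ 0 := by
    rintro rfl
    rw [pow_zero] at hv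
    subst hv
    exact ha1 (Subsingleton.elim _ _)
  have hpv : p ∣ v := hv ▸ dvd_pow_self p hn
  have hapow : a ^ p ^ n = 1 := by
    obtain ⟨s, hs⟩ := apply_pow_of_affine haff v
    have h1 : ∀ x, (h ^ v) x = x := fun x => by
      rw [apply_pow_of_conj_addRight_one hτ]; simp
    have h2 := hs 0
    have h3 := hs 1
    rw [h1] at h2 h3
    rw [mul_zero, zero_add] at h2
    rw [← h2, add_zero, mul_one] at h3
    -- Generalizing the exponent avoids rewriting `v` inside the type of `a`.
    have h4 : ∀ m, m = v → a ^ m = 1 := by rintro m rfl; exact h3.symm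
    exact h4 _ hv.symm
  have hap : (p : ZMod v) ∣ a - 1 := by
    rw [natCast_dvd_iff_castHom_eq_zero hpv, map_sub, map_one, sub_eq_zero]
    have h1 := congrArg (ZMod.castHom hpv (ZMod p)) hapow
    rwa [map_pow, ZMod.pow_card_pow, map_one] at h1
  have h4 : p = 2 → 4 ∣ v := by
    rintro rfl
    by_cases hn1 : n = 1
    · subst hn1
      rw [pow_one] at hv
      have h2 : ((2 : ℕ) : ZMod v) = 0 := by rw [ZMod.natCast_eq_zero_iff, hv]
      rw [h2, zero_dvd_iff, sub_eq_zero] at hap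
      exact absurd hap ha1
    · rw [hv, show 4 = 2 ^ 2 by norm_num]
      exact pow_dvd_pow 2 (by omega)
  have hap4 : p = 2 → ((4 : ℕ) : ZMod v) ∣ a - 1 := by
    rintro rfl
    rw [natCast_dvd_iff_castHom_eq_zero (h4 rfl), map_sub, map_one, sub_eq_zero]
    obtain ⟨k, hk⟩ := hap
    exact castHom_four_eq_one (h4 rfl) hτ haff ⟨k, by rw [hk]; norm_num⟩
  -- The last nontrivial iterated p-th power b has b^p = 1, so e = b - 1 is nonzero and killed by p.
  obtain ⟨j, hj1, hj⟩ : ∃ j, a ^ p ^ j ≠ 1 ∧ a ^ p ^ (j + 1) = 1 := by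
    by_contra! hcon
    have : ∀ j, a ^ p ^ j ≠ 1 := by
      intro j
      induction j with
      | zero => simpa using ha1
      | succ j ih => exact hcon j ih
    exact this n hapow
  obtain ⟨s, hs⟩ := apply_pow_of_affine haff (p ^ j)
  set b := a ^ p ^ j with hb
  have hab : a - 1 ∣ b - 1 := by simpa using sub_dvd_pow_sub_pow a 1 (p ^ j)
  have hlift : ∀ m : ℕ, m ∣ v → (m : ZMod v) ∣ b - 1 → (m : ℤ) ∣ (b.val : ℤ) - 1 := by
    intro m hm hd
    rw [natCast_dvd_iff_castHom_eq_zero hm, ← ZMod.natCast_zmod_val b, map_sub, map_one,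
      map_natCast] at hd
    rw [← ZMod.intCast_zmod_eq_zero_iff_dvd]
    push_cast
    exact hd
  have hbv : (((b.val : ℤ)) : ZMod v) = b := by simp
  have hpe : (p : ZMod v) * (b - 1) = 0 := by
    have := ZMod.mul_sub_one_eq_zero_of_pow_eq_one hp hv (a := b.val)
      (hlift p hpv (hap.trans hab))
      (fun h => by exact_mod_cast hlift 4 (h4 h) ((hap4 h).trans hab))
      (by rw [hbv, hb, ← pow_mul, ← pow_succ, hj])
    rwa [hbv] at this
  obtain ⟨u, hu⟩ := ((translateAut B).pow_mem hh (p ^ j)).1 0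
  refine hB.false_of_affine_invariant hp hv hpv hcard ?_ (sub_ne_zero.2 hj1) hpe (hap.trans hab)
    (t := u - s) fun x hx => ?_
  · by_contra! hcon
    have h1 : AddSubgroup.closure {d : ZMod v | ∃ a ∈ B, ∃ b ∈ B, a - b = d} ≤
        (ZMod.castHom hpv (ZMod p)).toAddMonoidHom.ker := by
      rw [AddSubgroup.closure_le]
      rintro _ ⟨x, hx, y, hy, rfl⟩
      exact (natCast_dvd_iff_castHom_eq_zero hpv).1 (hcon x hx y hy)
    rw [hgen] at h1
    have h2 : ZMod.castHom hpv (ZMod p) 1 = 0 := h1 (AddSubgroup.mem_top 1)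
    rw [map_one] at h2
    exact one_ne_zero h2
  · have h1 := (hu x).1 (by simpa using hx)
    rw [hs] at h1
    rwa [show x + (b - 1) * x - (u - s) = b * x + s - u by ring]

/-- By finiteness, mapping the subgroup into itself suffices, and that can be tested on a generator.
-/
theorem mem_normalizer_zpowers_of_conj_mem {Γ : Type*} [Group Γ] [Finite Γ] {c g : Γ}
    (h : g * c * g⁻¹ ∈ Subgroup.zpowers c) :
    g ∈ Subgroup.normalizer (Subgroup.zpowers c : Set Γ) := by
  refine Subgroup.mem_normalizer_fintype ?_
  rintro _ ⟨i, rfl⟩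
  simp only [SetLike.mem_coe]
  rw [← conj_zpow]
  exact Subgroup.zpow_mem _ h i

/-- In a `p`-group, a cyclic subgroup `⟨c⟩` such that every conjugate of `c` normalizing `⟨c⟩` lies
in `⟨c⟩` is normal. -/
theorem IsPGroup.conj_mem_zpowers {Γ : Type*} [Group Γ] [Finite Γ] {p : ℕ} (hp : p.Prime)
    (hΓ : IsPGroup p Γ) {c : Γ}
    (hc : ∀ g : Γ, g * c * g⁻¹ ∈ Subgroup.normalizer (Subgroup.zpowers c : Set Γ) →
      g * c * g⁻¹ ∈ Subgroup.zpowers c) :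
    Subgroup.normalizer (Subgroup.zpowers c : Set Γ) = ⊤ := by
  have := Fact.mk hp
  have := hΓ.isNilpotent
  have hnc : NormalizerCondition Γ := Group.normalizerCondition_of_isNilpotent
  refine normalizerCondition_iff_only_full_group_self_normalizing.1 hnc _ ?_
  -- The hypothesis makes the normalizer of ⟨c⟩ self-normalizing; in a nilpotent group it is then
  -- everything.
  refine le_antisymm (fun g hg => mem_normalizer_zpowers_of_conj_mem (hc g ?_))
    Subgroup.le_normalizer
  exact (Subgroup.mem_normalizer_iff.1 hg c).1 (Subgroup.le_normalizer (Subgroup.mem_zpowers c))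

/-- In a finite group, let `R` be a conjugation invariant property of elements, and let `c` and `d`
have property `R` and `p`-power order. If every element with property `R` which normalizes `⟨c⟩`
lies in `⟨c⟩`, then `d` is conjugate to an element of `⟨c⟩`. -/
theorem exists_conj_mem_zpowers_of_isPGroup {Γ : Type*} [Group Γ] [Finite Γ] {p : ℕ}
    (hp : p.Prime) {c d : Γ} {R : Γ → Prop} (hRc : R c) (hRd : R d)
    (hR : ∀ g x, R x → R (g * x * g⁻¹)) {m : ℕ} (hcm : c ^ p ^ m = 1) (hdm : d ^ p ^ m = 1)
    (h : ∀ x, R x → x ∈ Subgroup.normalizer (Subgroup.zpowers c : Set Γ) →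
      x ∈ Subgroup.zpowers c) : ∃ g : Γ, g * d * g⁻¹ ∈ Subgroup.zpowers c := by
  have := Fact.mk hp
  have hpg : ∀ x : Γ, x ^ p ^ m = 1 → IsPGroup p (Subgroup.zpowers x) := by
    intro x hx
    rw [IsPGroup.iff_card, Nat.card_zpowers]
    obtain ⟨k, -, hk⟩ := (Nat.dvd_prime_pow hp).1 (orderOf_dvd_of_pow_eq_one hx)
    exact ⟨k, hk⟩
  obtain ⟨P, hP⟩ := (hpg c hcm).exists_le_sylow
  obtain ⟨Q, hQ⟩ := (hpg d hdm).exists_le_sylow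
  obtain ⟨g, hg⟩ := MulAction.exists_smul_eq Γ Q P
  refine ⟨g, ?_⟩
  have hcP : c ∈ P := hP (Subgroup.mem_zpowers c)
  have hdP : g * d * g⁻¹ ∈ P := by
    rw [← hg]
    exact ⟨d, hQ (Subgroup.mem_zpowers d), rfl⟩
  refine h _ (hR g d hRd) ?_
  have hmem : ∀ x : P, x ∈ Subgroup.normalizer (Subgroup.zpowers (⟨c, hcP⟩ : P) : Set P) →
      x.1 ∈ Subgroup.normalizer (Subgroup.zpowers c : Set Γ) := by
    intro x hx
    refine mem_normalizer_zpowers_of_conj_mem ?_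
    obtain ⟨i, hi⟩ := (Subgroup.mem_normalizer_iff.1 hx ⟨c, hcP⟩).1 (Subgroup.mem_zpowers _)
    exact ⟨i, congrArg Subtype.val hi⟩
  have htop := IsPGroup.conj_mem_zpowers hp P.isPGroup' (c := ⟨c, hcP⟩) fun x hx => by
    obtain ⟨i, hi⟩ := h _ (hR x.1 c hRc) (hmem _ hx)
    exact ⟨i, Subtype.ext hi⟩
  exact hmem ⟨_, hdP⟩ (htop ▸ Subgroup.mem_top _)

end PrimePowerConj

/-! ### From conjugacy to multipliers, and reduction to generating sets -/

section Multiplier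

variable {v : ℕ}

theorem exists_conj_mem_zpowers_translateAut [NeZero v]
    (hv : (∃ p q : ℕ, p.Prime ∧ q.Prime ∧ p < q ∧ v = p * q) ∨ (∃ p n : ℕ, p.Prime ∧ v = p ^ n))
    {B : Finset (ZMod v)} (hB : IsSidonSet B) (hcard : 3 ≤ B.card)
    (hgen : IsDifferenceGenerating B) {d τ : Equiv.Perm (ZMod v)} (hd : d ∈ translateAut B)
    (hτ : d = τ * Equiv.addRight 1 * τ⁻¹) :
    ∃ g ∈ translateAut B,
      g * d * g⁻¹ ∈ Subgroup.zpowers (Equiv.addRight (1 : ZMod v) : Equiv.Perm (ZMod v)) := by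
  have hne : B.Nonempty := Finset.card_pos.1 (by omega)
  have hc : (Equiv.addRight (1 : ZMod v) : Equiv.Perm (ZMod v)) ∈ translateAut B :=
    mapsTranslates_addRight B 1
  have hpow : ∀ f : Equiv.Perm (ZMod v), (∃ τ, f = τ * Equiv.addRight 1 * τ⁻¹) → f ^ v = 1 := by
    rintro f ⟨τ, h⟩
    ext x
    rw [apply_pow_of_conj_addRight_one h]
    simp
  rcases hv with ⟨p, q, hp, hq, hpq, hv⟩ | ⟨p, n, hp, hv⟩
  · refine exists_conj_mem_zpowers_of_two_primes hp hq hpq hv rfl hc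
      (fun g hg hgc hgn h0 => hB.eq_one_of_centralizer hp hq hpq ⟨q, hv⟩ hne hgen hg hgc hgn h0)
      hd ?_
    refine Eq.trans ?_ (orderOf_addRight_one v)
    rw [hτ]
    exact orderOf_injective (MulAut.conj τ).toMonoidHom (MulAut.conj τ).injective _
  · set c : translateAut B := ⟨_, hc⟩
    have hpow' : ∀ f : Equiv.Perm (ZMod v), (∃ τ, f = τ * Equiv.addRight 1 * τ⁻¹) →
        f ^ p ^ n = 1 := fun f h => by
      have h1 : ∀ m, m = v → f ^ m = 1 := by rintro m rfl; exact hpow f h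
      exact h1 _ hv.symm
    obtain ⟨g, i, hi⟩ := exists_conj_mem_zpowers_of_isPGroup hp (c := c) (d := ⟨d, hd⟩)
      (R := fun x => ∃ τ : Equiv.Perm (ZMod v), x.1 = τ * Equiv.addRight 1 * τ⁻¹)
      ⟨1, by rw [one_mul, inv_one, mul_one]⟩ ⟨τ, hτ⟩
      (by
        rintro g x ⟨ρ, hρ⟩
        refine ⟨g.1 * ρ, ?_⟩
        rw [Subgroup.coe_mul, Subgroup.coe_mul, hρ, Subgroup.coe_inv]
        group)
      (m := n) (Subtype.ext (hpow' _ ⟨1, by rw [one_mul, inv_one, mul_one]⟩))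
      (Subtype.ext (hpow' _ ⟨τ, hτ⟩))
      (by
        rintro x ⟨ρ, hρ⟩ hx
        obtain ⟨i, hi⟩ := (Subgroup.mem_normalizer_iff.1 hx c).1 (Subgroup.mem_zpowers c)
        have h1 : (Equiv.addRight (1 : ZMod v)) ^ i * x.1 = x.1 * Equiv.addRight (1 : ZMod v) := by
          have h2 := congrArg Subtype.val hi
          simp only [Subgroup.coe_zpow, Subgroup.coe_mul, Subgroup.coe_inv] at h2
          rw [eq_mul_inv_iff_mul_eq] at h2
          exact h2
        have haff := apply_eq_of_mul_addRight_one_eq (f := x.1) (i := (i : ZMod v)) fun y => by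
          have h2 := congrArg (fun f : Equiv.Perm (ZMod v) => f y) h1
          simp only [Equiv.Perm.mul_apply, addRight_one_zpow] at h2
          exact h2.symm
        have h3 := hB.eq_one_of_affine hp hv hcard hgen x.2 hρ
          (fun y => (haff y).trans (add_comm _ _))
        obtain ⟨j, hj⟩ := mem_zpowers_addRight_one (f := x.1) (t := x.1 0) fun y => by
          rw [haff y, h3, one_mul, add_comm]
        exact ⟨j, Subtype.ext hj⟩)
    exact ⟨g.1, g.2, i, congrArg Subtype.val hi⟩

/-- The multiplier theorem for generating Sidon sets. -/
theorem exists_multiplier_of_generating [NeZero v]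
    (hv : (∃ p q : ℕ, p.Prime ∧ q.Prime ∧ p < q ∧ v = p * q) ∨ (∃ p n : ℕ, p.Prime ∧ v = p ^ n))
    {B B' : Finset (ZMod v)} (hB : IsSidonSet B) (hcard : 3 ≤ B.card)
    (hgen : IsDifferenceGenerating B) {σ : Equiv.Perm (ZMod v)} (hσ : MapsTranslates B B' σ) :
    ∃ (a : (ZMod v)ˣ) (t : ZMod v), ∀ x, x ∈ B ↔ a * x + t ∈ B' := by
  have hd : σ⁻¹ * Equiv.addRight 1 * σ⁻¹⁻¹ ∈ translateAut B := by
    rw [inv_inv]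
    exact (hσ.trans (mapsTranslates_addRight B' 1)).trans hσ.symm
  obtain ⟨g, hg, i, hi⟩ := exists_conj_mem_zpowers_translateAut hv hB hcard hgen hd rfl
  set ρ : Equiv.Perm (ZMod v) := g * σ⁻¹ with hρ
  have hρB : MapsTranslates B B' ρ⁻¹ := by
    rw [hρ, mul_inv_rev, inv_inv]
    exact MapsTranslates.trans ((translateAut B).inv_mem hg) hσ
  have h1 : (Equiv.addRight (1 : ZMod v)) ^ i * ρ = ρ * Equiv.addRight (1 : ZMod v) := by
    simp only at hi
    rw [hi, hρ]
    group
  have haff := apply_eq_of_mul_addRight_one_eq (f := ρ) (i := (i : ZMod v)) fun y => by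
    have h2 := congrArg (fun f : Equiv.Perm (ZMod v) => f y) h1
    simp only [Equiv.Perm.mul_apply, addRight_one_zpow] at h2
    exact h2.symm
  -- Surjectivity of `ρ` solves i·x = 1.
  have hunit : IsUnit (i : ZMod v) := by
    have h2 := haff (ρ.symm (ρ 0 + 1))
    rw [Equiv.apply_symm_apply, add_right_inj] at h2
    exact IsUnit.of_mul_eq_one _ h2.symm
  obtain ⟨a, ha⟩ := hunit
  have hinv : ∀ y, ρ⁻¹ y = (a⁻¹ : (ZMod v)ˣ) * (y - ρ 0) := by
    intro y
    rw [Equiv.Perm.inv_eq_iff_eq, haff, ← ha, Units.mul_inv_cancel_left, add_sub_cancel]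
  obtain ⟨s, hs⟩ := hρB.1 0
  refine ⟨a⁻¹, -((a⁻¹ : (ZMod v)ˣ) * ρ 0) - s, fun x => ?_⟩
  have h3 := hs x
  rw [sub_zero, hinv] at h3
  rw [h3]
  ring_nf

/-- A subgroup of order n lies in the solutions of n·a = 0, of which a cyclic group has at most n.
-/
theorem AddSubgroup.eq_of_natCard_eq_of_isAddCyclic {A : Type*} [AddCommGroup A] [Finite A]
    [IsAddCyclic A] {H K : AddSubgroup A} (h : Nat.card H = Nat.card K) : H = K := by
  classical
  have := Fintype.ofFinite A
  have key : ∀ L : AddSubgroup A, Nat.card L = Nat.card H →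
      (L : Set A) = ({a | Nat.card H • a = 0} : Finset A) := by
    intro L hL
    refine Set.eq_of_subset_of_ncard_le (fun a ha => ?_) ?_
    · have h1 : Nat.card L • (⟨a, ha⟩ : L) = 0 := card_nsmul_eq_zero'
      rw [hL] at h1
      simpa using congrArg Subtype.val h1
    · rw [Set.ncard_coe_finset]
      refine (IsAddCyclic.card_nsmul_eq_zero_le Nat.card_pos).trans ?_
      rw [← hL]
      exact (Nat.card_coe_set_eq (L : Set A)).le
  exact SetLike.coe_injective ((key H rfl).trans (key K h.symm).symm)

/-- The subgroup generated by the differences of elements of `B`. -/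
def differenceSubgroup {A : Type*} [AddCommGroup A] (B : Finset A) : AddSubgroup A :=
  AddSubgroup.closure {d : A | ∃ a ∈ B, ∃ b ∈ B, a - b = d}

theorem sub_mem_differenceSubgroup {A : Type*} [AddCommGroup A] {B : Finset A} {a b : A}
    (ha : a ∈ B) (hb : b ∈ B) : a - b ∈ differenceSubgroup B :=
  AddSubgroup.subset_closure ⟨a, ha, b, hb, rfl⟩

/-- Two points on a common translate go to two points on a common translate, so `σ` carries cosets
of one difference subgroup into cosets of the other. -/
theorem MapsTranslates.apply_add_sub_mem {A : Type*} [AddCommGroup A] {B B' : Finset A}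
    {σ : Equiv.Perm A} (hσ : MapsTranslates B B' σ) {d : A} (hd : d ∈ differenceSubgroup B) :
    ∀ x, σ (x + d) - σ x ∈ differenceSubgroup B' := by
  induction hd using AddSubgroup.closure_induction with
  | mem d h =>
    obtain ⟨a, ha, b, hb, rfl⟩ := h
    intro x
    obtain ⟨s, hs⟩ := hσ.1 (x - b)
    have h1 := (hs (x + (a - b))).1 (by rwa [show x + (a - b) - (x - b) = a by abel])
    have h2 := (hs x).1 (by rwa [sub_sub_cancel])
    simpa using sub_mem_differenceSubgroup h1 h2
  | zero => simp
  | add d e _ _ hd he =>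
    intro x
    simpa [add_assoc] using add_mem (he (x + d)) (hd x)
  | neg d _ hd =>
    intro x
    simpa using neg_mem (hd (x + -d))

theorem MapsTranslates.card_differenceSubgroup_le {A : Type*} [AddCommGroup A] [Finite A]
    {B B' : Finset A} {σ : Equiv.Perm A} (hσ : MapsTranslates B B' σ) :
    Nat.card (differenceSubgroup B) ≤ Nat.card (differenceSubgroup B') := by
  refine Nat.card_le_card_of_injective
    (fun d => (⟨σ (0 + d.1) - σ 0, hσ.apply_add_sub_mem d.2 0⟩ : differenceSubgroup B')) ?_
  intro d e h
  simpa using congrArg Subtype.val h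

/-- If a permutation of `ℤ/v` maps the translates of a Sidon set with at least three elements onto
the translates of another set, then these sets are equivalent under a multiplier. -/
theorem IsSidonSet.exists_multiplier [NeZero v]
    (hv : (∃ p q : ℕ, p.Prime ∧ q.Prime ∧ v = p * q) ∨ (∃ p n : ℕ, p.Prime ∧ v = p ^ n))
    {B B' : Finset (ZMod v)} (hB : IsSidonSet B) (hcard : 3 ≤ B.card)
    {σ : Equiv.Perm (ZMod v)} (hσ : MapsTranslates B B' σ) :
    ∃ (a : (ZMod v)ˣ) (t : ZMod v), ∀ x, x ∈ B ↔ a * x + t ∈ B' := by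
  classical
  set H := differenceSubgroup B with hH
  have hHB' : H = differenceSubgroup B' := AddSubgroup.eq_of_natCard_eq_of_isAddCyclic
    (le_antisymm hσ.card_differenceSubgroup_le hσ.symm.card_differenceSubgroup_le)
  set m := Nat.card H with hm
  have : NeZero m := ⟨Nat.card_pos.ne'⟩
  have hmv : m ∣ v := by
    have := AddSubgroup.card_addSubgroup_dvd_card H
    rwa [Nat.card_zmod] at this
  -- The admissible orders are closed under divisors; the case p = q and the trivial group count as
  -- prime powers.
  have hmv' : (∃ p q : ℕ, p.Prime ∧ q.Prime ∧ p < q ∧ m = p * q) ∨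
      (∃ p n : ℕ, p.Prime ∧ m = p ^ n) := by
    rcases hv with ⟨p, q, hp, hq, h⟩ | ⟨p, n, hp, h⟩
    · rw [h] at hmv
      obtain ⟨m₁, m₂, h1, h2, h3⟩ := exists_dvd_and_dvd_of_dvd_mul hmv
      rcases (Nat.dvd_prime hp).1 h1 with rfl | rfl <;> rcases (Nat.dvd_prime hq).1 h2 with rfl | rfl
      · exact Or.inr ⟨p, 0, hp, by simpa using h3⟩
      · exact Or.inr ⟨m₂, 1, hq, by simpa using h3⟩
      · exact Or.inr ⟨m₁, 1, hp, by simpa using h3⟩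
      · rcases lt_trichotomy m₁ m₂ with h4 | h4 | h4
        · exact Or.inl ⟨m₁, m₂, hp, hq, h4, h3⟩
        · exact Or.inr ⟨m₁, 2, hp, by rw [h3, h4, pow_two]⟩
        · exact Or.inl ⟨m₂, m₁, hq, hp, h4, by rw [h3, mul_comm]⟩
    · rw [h] at hmv
      obtain ⟨k, -, hk⟩ := (Nat.dvd_prime_pow hp).1 hmv
      exact Or.inr ⟨p, k, hp, hk⟩
  let e : ZMod m ≃+ H := zmodAddCyclicAddEquiv inferInstance
  let ι : ZMod m →+ ZMod v := H.subtype.comp e.toAddMonoidHom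
  have hι : Function.Injective ι := Subtype.val_injective.comp e.injective
  have hιmem : ∀ y, ι y ∈ H := fun y => (e y).2
  have hιsurj : ∀ z ∈ H, ∃ y, ι y = z := fun z hz => ⟨e.symm ⟨z, hz⟩, by
    change (e (e.symm ⟨z, hz⟩)).1 = z
    rw [e.apply_symm_apply]⟩
  obtain ⟨b, hb⟩ : B.Nonempty := Finset.card_pos.1 (by omega)
  obtain ⟨s₀, hs₀⟩ := hσ.1 0
  -- The base points `b` and `b'` move both sets into the common difference subgroup, which is then
  -- identified with ℤ/m.
  set b' := σ b - s₀ with hb'def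
  have hb' : b' ∈ B' := (hs₀ b).1 (by simpa using hb)
  set B₁ : Finset (ZMod m) := Finset.univ.filter fun y => b + ι y ∈ B with hB₁
  set B₁' : Finset (ZMod m) := Finset.univ.filter fun y => b' + ι y ∈ B' with hB₁'
  have hmem : ∀ y, y ∈ B₁ ↔ b + ι y ∈ B := by simp [hB₁]
  have hmem' : ∀ y, y ∈ B₁' ↔ b' + ι y ∈ B' := by simp [hB₁']
  have hBeq : B = B₁.image (fun y => b + ι y) := by
    ext x
    simp only [Finset.mem_image, hmem]
    constructor
    · intro hx
      obtain ⟨y, hy⟩ := hιsurj _ (sub_mem_differenceSubgroup hx hb)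
      exact ⟨y, by rw [hy, add_sub_cancel]; exact hx, by rw [hy, add_sub_cancel]⟩
    · rintro ⟨y, hy, rfl⟩
      exact hy
  have hinj : Function.Injective fun y => b + ι y := fun y z h => hι (add_left_cancel h)
  have hB₁S : IsSidonSet B₁ := by
    intro x hx y hy z hz w hw h
    have := hB _ ((hmem x).1 hx) _ ((hmem y).1 hy) _ ((hmem z).1 hz) _ ((hmem w).1 hw)
      (by simp only [add_sub_add_left_eq_sub, ← map_sub, h])
    exact this.imp (fun h => hinj h) (fun h => hinj h)
  have hB₁c : 3 ≤ B₁.card := by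
    rwa [hBeq, Finset.card_image_of_injective _ hinj] at hcard
  have hB₁g : IsDifferenceGenerating B₁ := by
    rw [IsDifferenceGenerating, eq_top_iff]
    intro y _
    have h1 : H ≤ (AddSubgroup.closure {d : ZMod m | ∃ a ∈ B₁, ∃ b ∈ B₁, a - b = d}).map ι := by
      rw [hH, differenceSubgroup, AddSubgroup.closure_le]
      rintro _ ⟨x', hx', z', hz', rfl⟩
      obtain ⟨x, hx, rfl⟩ := Finset.mem_image.1 (hBeq ▸ hx')
      obtain ⟨z, hz, rfl⟩ := Finset.mem_image.1 (hBeq ▸ hz')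
      exact ⟨x - z, AddSubgroup.subset_closure ⟨x, hx, z, hz, rfl⟩, by simp⟩
    obtain ⟨z, hz, hzy⟩ := h1 (hιmem y)
    rwa [← hι hzy]
  have hσH : ∀ y, σ (b + ι y) - σ b ∈ H := fun y => by
    rw [hHB']; exact hσ.apply_add_sub_mem (hιmem y) b
  choose f hf using fun y => hιsurj _ (hσH y)
  have hfinj : Function.Injective f := by
    intro y z h
    have h1 := hf y
    rw [h, hf z, sub_left_inj] at h1
    exact (hinj (σ.injective h1)).symm
  let σ₁ : Equiv.Perm (ZMod m) := Equiv.ofBijective f (Finite.injective_iff_bijective.1 hfinj)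
  have hσ₁ : ∀ y, σ (b + ι y) = s₀ + b' + ι (σ₁ y) := by
    intro y
    change _ = s₀ + b' + ι (f y)
    rw [hf, hb'def]
    abel
  have hB₁ne : B₁.Nonempty := Finset.card_pos.1 (by omega)
  have hB₁'0 : (0 : ZMod m) ∈ B₁' := by rw [hmem']; simpa using hb'
  have hmaps : MapsTranslates B₁ B₁' σ₁ := by
    constructor
    · intro t
      obtain ⟨s, hs⟩ := hσ.1 (ι t)
      have h0 : σ (b + ι t) - s ∈ B' := (hs _).1 (by simpa using hb)
      obtain ⟨u, hu⟩ := hιsurj (s - s₀) (by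
        have h1 := sub_mem_differenceSubgroup hb' h0
        rw [← hHB'] at h1
        have h2 := H.add_mem h1 (hσH t)
        rwa [hb'def, show σ b - s₀ - (σ (b + ι t) - s) + (σ (b + ι t) - σ b) = s - s₀ by abel]
          at h2)
      refine ⟨u, fun y => ?_⟩
      rw [hmem, hmem', map_sub, map_sub, hu, ← add_sub_assoc, hs, hσ₁]
      rw [show s₀ + b' + ι (σ₁ y) - s = b' + (ι (σ₁ y) - (s - s₀)) by abel]
    · intro u
      obtain ⟨t', ht'⟩ := hσ.2 (s₀ + ι u)
      have h0 : σ (b + ι (σ₁.symm u)) - (s₀ + ι u) ∈ B' := by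
        rw [hσ₁, Equiv.apply_symm_apply]
        rwa [show s₀ + b' + ι u - (s₀ + ι u) = b' by abel]
      obtain ⟨t, ht⟩ := hιsurj t' (by
        have h1 := sub_mem_differenceSubgroup hb ((ht' _).2 h0)
        have h2 := H.add_mem h1 (hιmem (σ₁.symm u))
        rwa [show b - (b + ι (σ₁.symm u) - t') + ι (σ₁.symm u) = t' by abel] at h2)
      refine ⟨t, fun y => ?_⟩
      rw [hmem, hmem', map_sub, map_sub, ht, ← add_sub_assoc, ht', hσ₁]
      rw [show s₀ + b' + ι (σ₁ y) - (s₀ + ι u) = b' + (ι (σ₁ y) - ι u) by abel]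
  obtain ⟨a₁, t₁, ha₁⟩ := exists_multiplier_of_generating hmv' hB₁S hB₁c hB₁g hmaps
  -- A multiplier of ℤ/m extends to one of ℤ/v that induces it on the subgroup.
  obtain ⟨a, ha⟩ := ZMod.unitsMap_surjective hmv a₁
  have hιmul : ∀ y, ι (a₁ * y) = a * ι y := by
    intro y
    have h1 : (a₁ : ZMod m) = (((a : ZMod v).val : ℕ) : ZMod m) := by
      rw [← ha, ZMod.unitsMap_val, ZMod.natCast_val]
    rw [h1, ← nsmul_eq_mul, map_nsmul, nsmul_eq_mul, ZMod.natCast_zmod_val]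
  have hfwd : ∀ x ∈ B, a * x + (b' - a * b + ι t₁) ∈ B' := by
    intro x hx
    obtain ⟨y, hy, rfl⟩ := Finset.mem_image.1 (hBeq ▸ hx)
    have h1 := (hmem' _).1 ((ha₁ y).1 hy)
    rw [map_add, hιmul] at h1
    rwa [show a * (b + ι y) + (b' - a * b + ι t₁) = b' + (a * ι y + ι t₁) by ring]
  refine ⟨a, b' - a * b + ι t₁, fun x => ⟨hfwd x, fun hx => ?_⟩⟩
  obtain ⟨z, hz⟩ := hιsurj (a * x + (b' - a * b + ι t₁) - b')
    (hHB' ▸ sub_mem_differenceSubgroup hx hb')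
  have h1 : x = b + ι (a₁⁻¹ * (z - t₁) : ZMod m) := by
    have h2 : a * ι ((a₁⁻¹ : (ZMod m)ˣ) * (z - t₁)) = ι z - ι t₁ := by
      rw [← hιmul, Units.mul_inv_cancel_left, map_sub]
    rw [hz] at h2
    have h3 := a.isUnit.mul_left_cancel (h2.trans (by ring : _ = a * (x - b)))
    rw [h3, add_sub_cancel]
  rw [h1, ← hmem, ha₁, Units.mul_inv_cancel_left, sub_add_cancel, hmem', hz, add_sub_cancel]
  exact hx

end Multiplier

/-! ### Base lines, and configurations as relational structures -/

section Configurations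

namespace IncidenceGeometry

theorem isIsomorphism_iff {P Q : Type*} [DecidableEq P] [DecidableEq Q] {C : IncidenceGeometry P}
    {D : IncidenceGeometry Q} {σ : P ≃ Q} :
    C.IsIsomorphism D σ ↔ ∀ L : Finset P, L ∈ C.lines ↔ L.map σ.toEmbedding ∈ D.lines := by
  unfold IsIsomorphism
  constructor
  · intro h L
    rw [← h, Finset.mem_image]
    exact ⟨fun hL => ⟨L, hL, rfl⟩, fun ⟨L', hL', h'⟩ => (Finset.map_injective _ h') ▸ hL'⟩
  · intro h
    ext L
    rw [Finset.mem_image]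
    constructor
    · rintro ⟨L', hL', rfl⟩
      exact (h L').1 hL'
    · intro hL
      have h1 : (L.map σ.symm.toEmbedding).map σ.toEmbedding = L := by
        ext x; simp
      exact ⟨L.map σ.symm.toEmbedding, (h _).2 (h1.symm ▸ hL), h1⟩

variable {v : ℕ}

/-- The translate of a set of residues. -/
def shift (L : Finset (ZMod v)) (t : ZMod v) : Finset (ZMod v) :=
  L.map (Equiv.addRight t).toEmbedding

theorem mem_shift {L : Finset (ZMod v)} {t x : ZMod v} : x ∈ shift L t ↔ x - t ∈ L := by
  simp [shift, sub_eq_add_neg]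

theorem shift_shift (L : Finset (ZMod v)) (s t : ZMod v) :
    shift (shift L s) t = shift L (s + t) := by
  ext x
  rw [mem_shift, mem_shift, mem_shift, sub_sub, add_comm]

theorem IsCyclic.shift_mem [NeZero v] {C : IncidenceGeometry (ZMod v)} (hC : C.IsCyclic)
    {L : Finset (ZMod v)} (hL : L ∈ C.lines) (t : ZMod v) : shift L t ∈ C.lines := by
  have key : ∀ n : ℕ, shift L n ∈ C.lines := by
    intro n
    induction n with
    | zero => convert hL; ext x; simp [mem_shift]
    | succ n ih =>
      have := (isIsomorphism_iff.1 hC _).1 ih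
      rw [Nat.cast_succ, ← shift_shift]
      exact this
  simpa using key t.val

theorem shift_eq_of_mem [NeZero v] {C : IncidenceGeometry (ZMod v)} (hC : C.IsCyclic)
    {L : Finset (ZMod v)} (hL : L ∈ C.lines) {t x y : ZMod v} (hxy : x ≠ y) (hx : x ∈ L)
    (hy : y ∈ L) (hxt : x - t ∈ L) (hyt : y - t ∈ L) : shift L t = L := by
  by_contra hne
  have h1 := C.card_inter_le_one _ (hC.shift_mem hL t) _ hL hne
  exact hxy (Finset.card_le_one.1 h1 x (Finset.mem_inter.2 ⟨mem_shift.2 hxt, hx⟩) y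
    (Finset.mem_inter.2 ⟨mem_shift.2 hyt, hy⟩))

/-- Counting flags in two ways gives vk = vr. -/
theorem IsBalanced.exists_card [NeZero v] {C : IncidenceGeometry (ZMod v)} (hC : C.IsBalanced) :
    ∃ k, 3 ≤ k ∧ (∀ x, (C.lines.filter (fun B => x ∈ B)).card = k) ∧
      ∀ B ∈ C.lines, B.card = k := by
  obtain ⟨⟨r, k, hr, hk, h3⟩, hcard⟩ := hC
  have h1 := Finset.sum_card hr
  rw [Finset.sum_congr rfl hk, Finset.sum_const, hcard, Nat.card_zmod, ZMod.card,
    smul_eq_mul] at h1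
  have h2 : k = r := Nat.eq_of_mul_eq_mul_left (NeZero.pos v) h1
  exact ⟨k, h3, h2 ▸ hr, hk⟩

/-- Two lines through `0` which are both invariant under a nontrivial translation coincide. -/
theorem eq_of_shift_eq [NeZero v] {C : IncidenceGeometry (ZMod v)} (hC : C.IsCyclic) {k : ℕ}
    (hk0 : 0 < k) (hk : ∀ B ∈ C.lines, B.card = k) {L L' : Finset (ZMod v)} (hL : L ∈ C.lines)
    (hL' : L' ∈ C.lines) (h0 : 0 ∈ L) (h0' : 0 ∈ L') (hs : ∃ t ≠ 0, shift L t = L)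
    (hs' : ∃ t ≠ 0, shift L' t = L') : L = L' := by
  -- For x in `L`, the translate by x shares x and x + t with `L`, hence equals it. Summing the
  -- elements of `L` before and after gives kx = 0, which has at most k solutions.
  have key : ∀ L ∈ C.lines, 0 ∈ L → (∃ t ≠ 0, shift L t = L) →
      L = ({x | k • x = 0} : Finset (ZMod v)) := by
    rintro L hL h0 ⟨t, ht0, ht⟩
    have hadd : ∀ x ∈ L, x + t ∈ L := fun x hx => by
      rw [← ht, mem_shift, add_sub_cancel_right]; exact hx
    refine Finset.eq_of_subset_of_card_le (fun x hx => ?_) ?_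
    · have h1 : shift L x = L := shift_eq_of_mem hC hL (x := x) (y := x + t) (by simpa using ht0)
        hx (hadd x hx) (by simpa using h0) (by simpa using hadd 0 h0)
      have h2 : ∑ y ∈ L, y = ∑ y ∈ L, (y + x) := by
        conv_lhs => rw [← h1]
        rw [shift, Finset.sum_map]
        rfl
      rw [Finset.sum_add_distrib, Finset.sum_const, hk L hL, left_eq_add] at h2
      simpa using h2
    · rw [hk L hL]
      exact IsAddCyclic.card_nsmul_eq_zero_le hk0
  rw [key L hL h0 hs, key L' hL' h0' hs']

/-- The lines of a balanced cyclic configuration are the translates of a Sidon set. -/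
theorem exists_base_line [NeZero v] {C : IncidenceGeometry (ZMod v)} (hC : C.IsCyclic)
    (hb : C.IsBalanced) : ∃ B : Finset (ZMod v), IsSidonSet B ∧ 3 ≤ B.card ∧
      ∀ L, L ∈ C.lines ↔ ∃ t, ∀ x, x ∈ L ↔ x - t ∈ B := by
  obtain ⟨k, hk3, hr, hk⟩ := hb.exists_card
  obtain ⟨B, hB, hfree⟩ : ∃ B ∈ C.lines, ∀ t, shift B t = B → t = 0 := by
    by_contra! hcon
    have h1 : 1 < (C.lines.filter (fun B => (0 : ZMod v) ∈ B)).card := by rw [hr]; omega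
    obtain ⟨L, hL, L', hL', hne⟩ := Finset.one_lt_card.1 h1
    rw [Finset.mem_filter] at hL hL'
    obtain ⟨t, ht, ht0⟩ := hcon L hL.1
    obtain ⟨t', ht', ht0'⟩ := hcon L' hL'.1
    exact hne (eq_of_shift_eq hC (by omega) hk hL.1 hL'.1 hL.2 hL'.2 ⟨t, ht0, ht⟩ ⟨t', ht0', ht'⟩)
  have hinj : Function.Injective (shift B) := by
    intro s t h
    have h1 : shift B (s - t) = B := by
      have := congrArg (fun L => shift L (-t)) h
      simp only [shift_shift, add_neg_cancel] at this
      rw [sub_eq_add_neg, this]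
      ext x; simp [mem_shift]
    exact sub_eq_zero.1 (hfree _ h1)
  -- The v distinct translates exhaust the v lines; this is where balance enters.
  have hlines : Finset.univ.image (shift B) = C.lines := by
    refine Finset.eq_of_subset_of_card_le
      (Finset.image_subset_iff.2 fun t _ => hC.shift_mem hB t) ?_
    rw [hb.2, Finset.card_image_of_injective _ hinj, Finset.card_univ, Nat.card_eq_fintype_card]
  refine ⟨B, ?_, by rw [hk B hB]; exact hk3, fun L => ?_⟩
  · intro a ha b hb' c hc d hd h
    by_contra! hcon
    -- If a - b = c - d, then `B` and its translate by c - a share both c and d.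
    have h1 := shift_eq_of_mem hC hB (t := c - a) (x := c) (y := d)
      (fun h' => hcon.1 (sub_eq_zero.1 (by rw [h, h', sub_self]))) hc hd
      (by rwa [sub_sub_cancel])
      (by rwa [show d - (c - a) = a - (c - d) by ring, ← h, sub_sub_cancel])
    exact hcon.2 (sub_eq_zero.1 (hfree _ h1)).symm
  · rw [← hlines, Finset.mem_image]
    constructor
    · rintro ⟨t, -, rfl⟩
      exact ⟨t, fun x => mem_shift⟩
    · rintro ⟨t, ht⟩
      exact ⟨t, Finset.mem_univ t, by ext x; rw [mem_shift, ht]⟩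

theorem MultiplierEquivalent.isomorphic {C D : IncidenceGeometry (ZMod v)}
    (h : C.MultiplierEquivalent D) : C.Isomorphic D :=
  h.imp' _ fun _ ha => ha

theorem Isomorphic.multiplierEquivalent [NeZero v]
    (hv : (∃ p q : ℕ, p.Prime ∧ q.Prime ∧ v = p * q) ∨ (∃ p n : ℕ, p.Prime ∧ v = p ^ n))
    {C D : IncidenceGeometry (ZMod v)} (hCb : C.IsBalanced) (hC : C.IsCyclic)
    (hDb : D.IsBalanced) (hD : D.IsCyclic) (h : C.Isomorphic D) : C.MultiplierEquivalent D := by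
  obtain ⟨σ, hσ⟩ := h
  obtain ⟨B, hB, hcard, hBC⟩ := exists_base_line hC hCb
  obtain ⟨B', -, -, hBD⟩ := exists_base_line hD hDb
  have hmaps : MapsTranslates B B' σ := by
    constructor
    · intro t
      have h1 := (isIsomorphism_iff.1 hσ _).1 ((hBC (shift B t)).2 ⟨t, fun x => mem_shift⟩)
      obtain ⟨s, hs⟩ := (hBD _).1 h1
      refine ⟨s, fun x => ?_⟩
      rw [← hs, ← mem_shift]
      simp
    · intro s
      have h1 : ((shift B' s).map σ.symm.toEmbedding).map σ.toEmbedding ∈ D.lines := by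
        rw [show ((shift B' s).map σ.symm.toEmbedding).map σ.toEmbedding = shift B' s by
          ext x; simp]
        exact (hBD _).2 ⟨s, fun x => mem_shift⟩
      obtain ⟨t, ht⟩ := (hBC _).1 ((isIsomorphism_iff.1 hσ _).2 h1)
      refine ⟨t, fun x => ?_⟩
      rw [← ht, ← mem_shift]
      simp
  obtain ⟨a, t, ha⟩ := hB.exists_multiplier hv hcard hmaps
  refine ⟨a, isIsomorphism_iff.2 fun L => ?_⟩
  have hmem : ∀ x, x ∈ L ↔ a * x ∈ L.map (Units.mulLeft a).toEmbedding := fun x => by simp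
  rw [hBC, hBD]
  constructor
  · rintro ⟨s, hs⟩
    refine ⟨a * s - t, fun y => ?_⟩
    obtain ⟨x, rfl⟩ := (Units.mulLeft a).surjective y
    rw [Units.mulLeft_apply, ← hmem, hs, ha]
    ring_nf
  · rintro ⟨s, hs⟩
    refine ⟨(a⁻¹ : (ZMod v)ˣ) * (s + t), fun x => ?_⟩
    rw [hmem, hs, ha, mul_sub, Units.mul_inv_cancel_left]
    ring_nf

/-- The image of an incidence geometry under a bijection. -/
def mapEquiv {P Q : Type*} [DecidableEq P] [DecidableEq Q] (C : IncidenceGeometry P) (σ : P ≃ Q) :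
    IncidenceGeometry Q where
  lines := C.lines.image (fun B => B.map σ.toEmbedding)
  card_inter_le_one := by
    intro B hB B' hB' hne
    obtain ⟨L, hL, rfl⟩ := Finset.mem_image.1 hB
    obtain ⟨L', hL', rfl⟩ := Finset.mem_image.1 hB'
    rw [← Finset.map_inter, Finset.card_map]
    exact C.card_inter_le_one L hL L' hL' fun h => hne (by rw [h])

theorem isIsomorphism_mapEquiv {P Q : Type*} [DecidableEq P] [DecidableEq Q]
    (C : IncidenceGeometry P) (σ : P ≃ Q) : C.IsIsomorphism (C.mapEquiv σ) σ := rfl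

theorem IsBalanced.mapEquiv {P Q : Type*} [DecidableEq P] [DecidableEq Q]
    {C : IncidenceGeometry P} (hC : C.IsBalanced) (σ : P ≃ Q) : (C.mapEquiv σ).IsBalanced := by
  have hinj : Function.Injective fun B : Finset P => B.map σ.toEmbedding :=
    Finset.map_injective _
  obtain ⟨⟨r, k, hr, hk, h3⟩, hcard⟩ := hC
  refine ⟨⟨r, k, fun y => ?_, ?_, h3⟩, ?_⟩
  · obtain ⟨x, rfl⟩ := σ.surjective y
    rw [← hr x, IncidenceGeometry.mapEquiv, Finset.filter_image,
      Finset.card_image_of_injective _ hinj]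
    congr 1
    ext B
    simp
  · intro B hB
    obtain ⟨L, hL, rfl⟩ := Finset.mem_image.1 hB
    rw [Finset.card_map, hk L hL]
  · rw [IncidenceGeometry.mapEquiv, Finset.card_image_of_injective _ hinj, hcard,
      Nat.card_congr σ]

/-- A line L is recovered from the relation of arity |L| by enumerating its points. -/
theorem toStructure_injective {P : Type*} [DecidableEq P] :
    Function.Injective (toStructure : IncidenceGeometry P → lineLanguage.Structure P) := by
  intro C D h
  have h1 : C.lines = D.lines := by
    ext L
    obtain ⟨f, hf⟩ : ∃ f : Fin L.card → P, Finset.univ.image f = L :=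
      ⟨fun i => (L.equivFin.symm i).1, by
        ext x
        simp only [Finset.mem_image, Finset.mem_univ, true_and]
        exact ⟨fun ⟨i, hi⟩ => hi ▸ (L.equivFin.symm i).2,
          fun hx => ⟨L.equivFin ⟨x, hx⟩, by simp⟩⟩⟩
    have h2 := congrArg (fun X : lineLanguage.Structure P =>
      @FirstOrder.Language.Structure.RelMap lineLanguage P X L.card () f) h
    rw [← hf]
    exact iff_of_eq h2
  cases C; cases D
  congr

theorem structureImage_toStructure {V : Type*} [DecidableEq V] (C : IncidenceGeometry V)
    (σ : Equiv.Perm V) : structureImage C.toStructure σ = (C.mapEquiv σ).toStructure := by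
  refine FirstOrder.Language.Structure.ext ?_ ?_
  · funext n f
    exact f.elim
  · funext n r x
    refine propext ?_
    change Finset.univ.image (σ.symm ∘ x) ∈ C.lines ↔ Finset.univ.image x ∈ (C.mapEquiv σ).lines
    rw [isIsomorphism_iff.1 (C.isIsomorphism_mapEquiv σ)]
    rw [show (Finset.univ.image (σ.symm ∘ x)).map σ.toEmbedding = Finset.univ.image x by
      ext y; simp]

theorem mapEquiv_eq_iff {P Q : Type*} [DecidableEq P] [DecidableEq Q] {C : IncidenceGeometry P}
    {D : IncidenceGeometry Q} {σ : P ≃ Q} : C.mapEquiv σ = D ↔ C.IsIsomorphism D σ := by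
  constructor
  · rintro rfl
    exact C.isIsomorphism_mapEquiv σ
  · intro h
    cases D
    unfold IsIsomorphism at h
    simp only at h
    subst h
    rfl

theorem toStructure_mem_cyclicObjects_iff {C : IncidenceGeometry (ZMod v)} :
    C.toStructure ∈ cyclicObjects lineLanguage v ↔ C.IsCyclic := by
  change structureImage C.toStructure _ = C.toStructure ↔ _
  rw [structureImage_toStructure, toStructure_injective.eq_iff, mapEquiv_eq_iff]
  rfl

end IncidenceGeometry

end Configurations

open IncidenceGeometry in
theorem theoremB (v : ℕ)
    (hv : (∃ p q : ℕ, p.Prime ∧ q.Prime ∧ v = p * q) ∨ (∃ p n : ℕ, p.Prime ∧ v = p ^ n)) :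
    (∀ C D : IncidenceGeometry (ZMod v),
      C.IsBalanced → C.IsCyclic → D.IsBalanced → D.IsCyclic →
        (C.Isomorphic D ↔ C.MultiplierEquivalent D)) ∧
    IsSolvingSet (balancedCyclicConfigurations v) (multipliers v) := by
  have : NeZero v := ⟨by
    rcases hv with ⟨p, q, hp, hq, rfl⟩ | ⟨p, n, hp, rfl⟩
    · exact mul_ne_zero hp.ne_zero hq.ne_zero
    · exact pow_ne_zero n hp.ne_zero⟩
  refine ⟨fun C D hCb hC hDb hD => ⟨fun h => h.multiplierEquivalent hv hCb hC hDb hD,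
    fun h => h.isomorphic⟩, ?_, ?_⟩
  · rintro _ ⟨C, -, hC, rfl⟩
    exact toStructure_mem_cyclicObjects_iff.2 hC
  · rintro _ ⟨C, hCb, hC, rfl⟩ Y hY
    refine ⟨?_, fun ⟨σ, _, hσ⟩ => ⟨σ, hσ⟩⟩
    rintro ⟨σ, rfl⟩
    -- The second object is only assumed to be a cyclic structure, but as an image of `C` it comes
    -- from a balanced configuration.
    rw [structureImage_toStructure] at hY ⊢
    obtain ⟨a, ha⟩ := Isomorphic.multiplierEquivalent hv hCb hC (hCb.mapEquiv σ)
      (toStructure_mem_cyclicObjects_iff.1 hY) ⟨σ, C.isIsomorphism_mapEquiv σ⟩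
    refine ⟨_, ⟨a, rfl⟩, ?_⟩
    rw [structureImage_toStructure, mapEquiv_eq_iff.2 ha]
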